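/- **Strings.** For a string $T$ let $\mathrm{Substr}(T)$ be the set of its substrings. A substring $x$ of $T$ is *left-maximal* in $T$ if $ax,bx\in\mathrm{Substr}(T)$ for two distinct characters $a,b$ or $x$ is a prefix of $T$; it is *right-maximal* in $T$ if $xa,xb\in\mathrm{Substr}(T)$ for two distinct characters $a,b$ or $x$ is a suffix of $T$. Let $\mathsf{LeftM}(T)$, $\mathsf{RightM}(T)$ be the sets of these substrings, $\mathsf M(T)=\mathsf{LeftM}(T)\cap\mathsf{RightM}(T)$ and $\mathsf{MR}(T)=\mathsf M(T)\setminus\{T\}$. Extending a substring $s$ of $T$ to the left in $T$ until it becomes left-maximal gives the shortest left-maximal substring of $T$ that has $s$ as a suffix. **CDAWG.** The compact directed acyclic word graph of $T$ has node set $\mathsf M(T)$. There is an edge with label $\beta\neq\varepsilon$ from $x\in\mathsf M(T)$ whenever $x\beta$ is right-maximal in $T$ and $x\gamma$ is not right-maximal for every non-empty proper prefix $\gamma$ of $\beta$; it leads to the node obtained by extending $x\beta$ to the left in $T$ until it becomes left-maximal. Let $\mathsf e(T)$ be the number of edges and $\mathsf d_T(x)$ the out-degree of the node $x$. **Edit.**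 Let $T'$ be obtained from $T$ by one edit operation at position $i$: the insertion of a character that becomes $T'[i]$, the substitution of another character for $T[i]$, or the deletion of $T[i]$. Assume that $T$ and $T'$ both end with the same character $\$$, which occurs only once in each of them. An occurrence $T'[j..k]$ of a non-empty string $x$ is *crossing* if, for an insertion or substitution, $k=i-1$ or $j\le i\le k$ or $j=i+1$, and, for a deletion, $k=i-1$ or $j\le i-1<i\le k$ or $j=i$. For a crossing occurrence $T'[j..k]$ of $x$ let its $S$-string be $T'[i..k]$ (which is $\varepsilon$ if $k=i-1$). Let $S_{x_L}$ and $S_{x_R}$ be the $S$-strings of the leftmost and of the rightmost crossing occurrence of $x$. **Classes of new maximal repeats.** Let $\mathsf N=(\mathsf M(T')\setminus\mathsf M(T))\setminus\{T'\}$, $\mathsf N_1=\mathsf N\cap\mathsf{RightM}(T)$, $\mathsf N_2=\mathsf N\cap\mathsf{LeftM}(T)$ and $\mathsf N_3=\mathsf N\setminus(\mathsf N_1\cup\mathsf N_2)$. Let $\mathsf N_{\mathrm{add}}$ be the set of $x\in\mathsf N_3$ such that (1) if all occurrences of $x$ in $T'$ are crossing, then $x\in\mathsf{MR}(T')$, and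 (2) for every character $a$ with $xa\in\mathrm{Substr}(T')$, some crossing occurrence of $x$ in $T'$ is followed by $a$. Let $\mathsf N_{\mathrm{base}}=\mathsf N_3\setminus\mathsf N_{\mathrm{add}}$. Associate $x\in\mathsf N_1\cup\mathsf N_{\mathrm{base}}$ with $S_{x_L}$ if there is no $y\in\mathsf N_1\cup\mathsf N_{\mathrm{base}}$ with $|y|>|x|$ and $S_{x_L}\in\{S_{y_L},S_{y_R}\}$, and with $S_{x_R}$ otherwise. Let $U(x)$ be the string obtained by extending the string associated with $x$ to the left in $T$ until it becomes left-maximal in $T$. Let $$\mathsf N_{\mathrm{mid}}=\{x\in\mathsf N_1\cup\mathsf N_{\mathrm{base}}\mid \mathsf d_{T'}(x)=\mathsf d_T(U(x))+1\},\qquad \mathsf N_{\mathrm{less}}=\{x\in\mathsf N_1\cup\mathsf N_{\mathrm{base}}\mid \mathsf d_{T'}(x)\le\mathsf d_T(U(x))\};$$ here a string $x$ for which $U(x)$ does not exist (because the associated string does not occur in $T$) belongs to neither set, and $\mathsf d_T(u)=0$ if $u$ is not a node. **Theorem.** For every such edit operation, $$\mathsf e(T')\;\le\;2\,\mathsf e(T)+5\,|\mathsf{MR}(T)|-|\mathsf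 N_{\mathrm{mid}}|-2\,|\mathsf N_{\mathrm{less}}|+|\mathsf N_2|+3 .$$ -/

import Mathlib

namespace CDAWG

variable {α : Type*}

/-! ### Maximal substrings

Strings are lists; `x <:+: T`, `x <+: T`, `x <:+ T` say that `x` is a substring, prefix, suffix
of `T`. -/

/-- The left-maximal substrings of `T`. -/
def LeftM (T : List α) : Set (List α) :=
  {x | x <:+: T ∧ ((∃ a b : α, a ≠ b ∧ (a :: x) <:+: T ∧ (b :: x) <:+: T) ∨ x <+: T)}

/-- The right-maximal substrings of `T`. -/
def RightM (T : List α) : Set (List α) :=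
  {x | x <:+: T ∧ ((∃ a b : α, a ≠ b ∧ (x ++ [a]) <:+: T ∧ (x ++ [b]) <:+: T) ∨ x <:+ T)}

/-- The maximal substrings of `T`, which are the nodes of the CDAWG of `T`. -/
def MaxSub (T : List α) : Set (List α) := LeftM T ∩ RightM T

/-- The maximal repeats of `T`. -/
def MR (T : List α) : Set (List α) := MaxSub T \ {T}

/-- `u` is obtained by extending `s` to the left in `T` until it becomes left-maximal in `T`:
it is the shortest left-maximal substring of `T` with suffix `s`. (There is none if `s` does not
occur in `T`, and exactly one otherwise.) -/
def IsLeftRep (T s u : List α) : Prop :=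
  u ∈ LeftM T ∧ s <:+ u ∧ ∀ v ∈ LeftM T, s <:+ v → u.length ≤ v.length

/-! ### The CDAWG -/

/-- The edges `(x, β, y)` of the CDAWG of `T`, from the node `x` to the node `y` with the non-empty
label `β`: the string `xβ` is the first right-maximal substring reached from `x` along `β` (so that
`β` labels an edge of the suffix tree leaving `x`), and `y` is the node in which `xβ` is merged. -/
def edges (T : List α) : Set (List α × List α × List α) :=
  {p | p.1 ∈ MaxSub T ∧ p.2.2 ∈ MaxSub T ∧ p.2.1 ≠ [] ∧
    p.1 ++ p.2.1 ∈ RightM T ∧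
    (∀ γ : List α, γ ≠ [] → γ <+: p.2.1 → γ ≠ p.2.1 → p.1 ++ γ ∉ RightM T) ∧
    IsLeftRep T (p.1 ++ p.2.1) p.2.2}

/-- The size of the CDAWG of `T`: its number of edges. -/
noncomputable def size (T : List α) : ℕ := (edges T).ncard

/-- The out-degree of the node `x` in the CDAWG of `T` (it is `0` if `x` is not a node). -/
noncomputable def outDeg (T x : List α) : ℕ := {p ∈ edges T | p.1 = x}.ncard

/-! ### Edit operations and crossing occurrences

Positions are counted from `0`; the occurrence of `x` that begins at `b` occupies the positions
`b, …, b + |x| - 1`. -/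

/-- The three kinds of single-character edit operations. -/
inductive EditKind
  | insertion
  | substitution
  | deletion

/-- `T'` is obtained from `T` by the edit operation of the given kind at position `i`: a new
character is inserted so that it becomes `T'[i]`, or `T[i]` is replaced by another character,
or `T[i]` is deleted. -/
def IsEdit : EditKind → ℕ → List α → List α → Prop
  | .insertion, i, T, T' =>
      ∃ (p s : List α) (c : α), p.length = i ∧ T = p ++ s ∧ T' = p ++ c :: s
  | .substitution, i, T, T' =>
      ∃ (p s : List α) (c d : α), c ≠ d ∧ p.length = i ∧ T = p ++ d :: s ∧ T' = p ++ c :: s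
  | .deletion, i, T, T' =>
      ∃ (p s : List α) (d : α), p.length = i ∧ T = p ++ d :: s ∧ T' = p ++ s

/-- `T` ends with the end-marker `d`, which occurs nowhere else in `T`. -/
def EndsWithMarker (d : α) (T : List α) : Prop := ∃ w : List α, d ∉ w ∧ T = w ++ [d]

/-- `x` occurs in `T` beginning at position `b`. -/
def OccursAt (T x : List α) (b : ℕ) : Prop := ∃ u v : List α, u.length = b ∧ T = u ++ x ++ v

/-- The positions `b, …, e - 1` touch the edited position `i` from the left, contain it, or touch
it from the right. (After a deletion, `i` stands for the gap between `i - 1` and `i`.) -/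
def Crosses : EditKind → ℕ → ℕ → ℕ → Prop
  | .deletion, i, b, e => e = i ∨ (b < i ∧ i < e) ∨ b = i
  | _, i, b, e => e = i ∨ (b ≤ i ∧ i < e) ∨ b = i + 1

/-- The beginning positions of the crossing occurrences of the non-empty string `x` in `T'`. -/
def crossPos (κ : EditKind) (i : ℕ) (T' x : List α) : Set ℕ :=
  {b | x ≠ [] ∧ OccursAt T' x b ∧ Crosses κ i b (b + x.length)}

/-- The substring of `T'` from the edited position `i` to the end of the occurrence of `x` that
begins at `b`; it is empty if this occurrence touches `i` from the left. -/
def sPart (i : ℕ) (T' x : List α) (b : ℕ) : List α := (T'.take (b + x.length)).drop i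

/-- The string `S` of the leftmost crossing occurrence of `x`. -/
noncomputable def sLeft (κ : EditKind) (i : ℕ) (T' x : List α) : List α :=
  sPart i T' x (sInf (crossPos κ i T' x))

/-- The string `S` of the rightmost crossing occurrence of `x`. -/
noncomputable def sRight (κ : EditKind) (i : ℕ) (T' x : List α) : List α :=
  sPart i T' x (sSup (crossPos κ i T' x))

/-! ### The classes of new maximal repeats -/

/-- The new maximal repeats. -/
def N (T T' : List α) : Set (List α) := (MaxSub T' \ MaxSub T) \ {T'}

def N₁ (T T' : List α) : Set (List α) := N T T' ∩ RightM T

def N₂ (T T' : List α) : Set (List α) := N T T' ∩ LeftM T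

def N₃ (T T' : List α) : Set (List α) := N T T' \ (N₁ T T' ∪ N₂ T T')

/-- The strings `x` of `N₃` such that `x` is a maximal repeat of `T'` if all its occurrences in
`T'` are crossing, and every right-extension of `x` in `T'` is one of a crossing occurrence. -/
def Nadd (κ : EditKind) (i : ℕ) (T T' : List α) : Set (List α) :=
  {x ∈ N₃ T T' |
    ((∀ b, OccursAt T' x b → b ∈ crossPos κ i T' x) → x ∈ MR T') ∧
    ∀ a : α, (x ++ [a]) <:+: T' → ∃ b ∈ crossPos κ i T' x, OccursAt T' (x ++ [a]) b}

def Nbase (κ : EditKind) (i : ℕ) (T T' : List α) : Set (List α) := N₃ T T' \ Nadd κ i T T'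

open Classical in
/-- The string `S` with which `x ∈ N₁ ∪ Nbase` is associated: that of the leftmost crossing
occurrence, unless it is also the string of the leftmost or rightmost crossing occurrence of a
longer member of `N₁ ∪ Nbase`, and that of the rightmost crossing occurrence in this case. -/
noncomputable def assocS (κ : EditKind) (i : ℕ) (T T' x : List α) : List α :=
  if ∃ y ∈ N₁ T T' ∪ Nbase κ i T T', x.length < y.length ∧
      (sLeft κ i T' x = sLeft κ i T' y ∨ sLeft κ i T' x = sRight κ i T' y)
  then sRight κ i T' x
  else sLeft κ i T' x

/-- `u` is the string `U(x)`. -/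
def IsU (κ : EditKind) (i : ℕ) (T T' x u : List α) : Prop := IsLeftRep T (assocS κ i T T' x) u

def Nmid (κ : EditKind) (i : ℕ) (T T' : List α) : Set (List α) :=
  {x ∈ N₁ T T' ∪ Nbase κ i T T' | ∃ u, IsU κ i T T' x u ∧ outDeg T' x = outDeg T u + 1}

def Nless (κ : EditKind) (i : ℕ) (T T' : List α) : Set (List α) :=
  {x ∈ N₁ T T' ∪ Nbase κ i T T' | ∃ u, IsU κ i T T' x u ∧ outDeg T' x ≤ outDeg T u}

end CDAWG

/-! By `size_eq_sum` the number of edges is the sum, over the nodes, of the number `rdeg` of letters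
that can follow the node. The nodes of `T'` other than `T'` itself, which has degree 0, fall into
the nodes `S` common with `T`, `A = N₂`, `B = N₁ ∪ Nbase` and `Nadd`. The last class splits into `K`
and `Q`, where `Q` consists of the repeats that occur in `T` but are not kept (`IsKept`). With `m =
|MR T|` the proof rests on four estimates: (I) the degrees over `S` and `A`, plus `|Q|`, are at most
`size T + |A| + m + 1` (`Edited.sum_rdeg_le`); (II) the degrees over `B`, with the gains of `Nmid`
and `Nless` added, are at most `size T + 2|B| + 2` (`Edited.sum_weight_le`); (III) `|B| + |Q| ≤ m`
(`Edited.card_add_card_le`); (IV) `|K| ≤ m` (`Edited.card_kept_le`). A member of `Nadd` has degree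
at most 2, so summing gives the coefficient 5 = 1 + 2 + 2 of `m` and the constant 3 = 1 + 2.

Two tools give these estimates. The first is a chain argument. Right-maximal substrings of `T` that
are comparable as prefixes have different left extensions, hence different nodes with the same
degrees; dually for left-maximal substrings comparable as suffixes. The windows of `T'` from `off`
to varying ends, or from varying starts to `i`, form such chains. Each estimate therefore reduces to
choosing, injectively, an end or a start for every repeat.

The second is periodicity. Crossing occurrences of `x` start within a range of length at most `|x| +
1`, so if there are three, all but the rightmost are followed by the same letter and all but the
leftmost are preceded by the same letter. Only the leftmost and the rightmost crossing occurrence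
matter. A repeat that is not left-maximal in `T` is always preceded there by one letter `c`; one of
its two extreme crossing occurrences is preceded by something else, and no longer substring of `T`
can end where that occurrence ends.

Estimate (IV) is the delicate one. The rightmost crossing start serves for some repeats, the left
end of the extension of the leftmost one for the others, and overlaps between the two kinds are
excluded by shifting occurrences and applying periodicity. -/

namespace CDAWG

variable {α : Type*}

/-! ### Occurrences and windows -/

/-- The substring of `T` on the positions `b, …, e - 1`. -/
def win (T : List α) (b e : ℕ) : List α := (T.take e).drop b

theorem length_win {T : List α} {b e : ℕ} (he : e ≤ T.length) : (win T b e).length = e - b := by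
  simp [win, Nat.min_eq_left he]

theorem getElem?_win {T : List α} {b e k : ℕ} (hk : b + k < e) : (win T b e)[k]? = T[b + k]? := by
  simp [win, hk]

theorem occursAt_iff {T x : List α} {b : ℕ} :
    OccursAt T x b ↔ b + x.length ≤ T.length ∧ ∀ k < x.length, T[b + k]? = x[k]? := by
  constructor
  · rintro ⟨u, v, rfl, rfl⟩
    refine ⟨by simp, fun k hk => ?_⟩
    rw [List.append_assoc, List.getElem?_append_right (by omega)]
    simp [List.getElem?_append_left hk]
  · rintro ⟨h, hx⟩
    refine ⟨T.take b, T.drop (b + x.length), by simp; omega, ?_⟩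
    have : x = (T.drop b).take x.length := by
      apply List.ext_getElem?
      intro k
      by_cases hk : k < x.length
      · simp [hk, hx k hk]
      · simp only [List.getElem?_take, hk, if_false]
        exact List.getElem?_eq_none (by omega)
    conv_rhs => rw [this]
    have h2 : T.drop (b + x.length) = (T.drop b).drop x.length := by simp
    simp only [List.length_take, List.length_drop]
    rw [Nat.min_eq_left (by omega), h2, List.append_assoc, List.take_append_drop,
      List.take_append_drop]

theorem infix_iff_exists_occursAt {T x : List α} : x <:+: T ↔ ∃ b, OccursAt T x b := by
  constructor
  · rintro ⟨u, v, h⟩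
    exact ⟨u.length, u, v, rfl, h.symm⟩
  · rintro ⟨b, u, v, _, h⟩
    exact ⟨u, v, h.symm⟩

theorem OccursAt.isInfix {T x : List α} {b : ℕ} (h : OccursAt T x b) : x <:+: T :=
  infix_iff_exists_occursAt.2 ⟨b, h⟩

theorem OccursAt.le {T x : List α} {b : ℕ} (h : OccursAt T x b) : b + x.length ≤ T.length :=
  (occursAt_iff.1 h).1

theorem OccursAt.eq_win {T x : List α} {b : ℕ} (h : OccursAt T x b) :
    x = win T b (b + x.length) := by
  have h' := occursAt_iff.1 h
  apply List.ext_getElem?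
  intro k
  by_cases hk : k < x.length
  · rw [getElem?_win (by omega), h'.2 k hk]
  · rw [List.getElem?_eq_none (by omega), List.getElem?_eq_none]
    rw [length_win h'.1]; omega

theorem occursAt_win {T : List α} {b e : ℕ} (hb : b ≤ e) (he : e ≤ T.length) :
    OccursAt T (win T b e) b := by
  rw [occursAt_iff, length_win he]
  exact ⟨by omega, fun k hk => (getElem?_win (by omega)).symm⟩

/-- The texts `T` and `T'` agree on the `n` positions from `b` and from `b'`. -/
def Agree (T T' : List α) (b b' n : ℕ) : Prop := ∀ k < n, T[b + k]? = T'[b' + k]?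

theorem OccursAt.agree {T T' x : List α} {b b' : ℕ} (h : OccursAt T x b) (h' : OccursAt T' x b') :
    Agree T T' b b' x.length := fun k hk => by
  rw [(occursAt_iff.1 h).2 k hk, (occursAt_iff.1 h').2 k hk]

theorem OccursAt.eq_of_length_eq {T x y : List α} {b : ℕ} (hx : OccursAt T x b)
    (hy : OccursAt T y b) (h : x.length = y.length) : x = y := by
  rw [hx.eq_win, hy.eq_win, h]

theorem occursAt_append_singleton {T x : List α} {a : α} {b : ℕ} :
    OccursAt T (x ++ [a]) b ↔ OccursAt T x b ∧ T[b + x.length]? = some a := by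
  simp only [occursAt_iff, List.length_append, List.length_singleton]
  constructor
  · rintro ⟨h1, h2⟩
    refine ⟨⟨by omega, fun k hk => ?_⟩, ?_⟩
    · rw [h2 k (by omega), List.getElem?_append_left hk]
    · rw [h2 x.length (by omega)]; simp
  · rintro ⟨⟨h1, h2⟩, h3⟩
    have := (List.getElem?_eq_some_iff.1 h3).1
    refine ⟨by omega, fun k hk => ?_⟩
    by_cases hk' : k < x.length
    · rw [h2 k hk', List.getElem?_append_left hk']
    · obtain rfl : k = x.length := by omega
      rw [h3]; simp

theorem occursAt_cons {T x : List α} {a : α} {b : ℕ} :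
    OccursAt T (a :: x) b ↔ OccursAt T x (b + 1) ∧ T[b]? = some a := by
  simp only [occursAt_iff, List.length_cons]
  constructor
  · rintro ⟨h1, h2⟩
    refine ⟨⟨by omega, fun k hk => ?_⟩, ?_⟩
    · have := h2 (k + 1) (by omega)
      simpa [add_assoc, add_comm 1 k] using this
    · simpa using h2 0 (by omega)
  · rintro ⟨⟨h1, h2⟩, h3⟩
    refine ⟨by omega, fun k hk => ?_⟩
    rcases k with _ | k
    · simpa using h3
    · have := h2 k (by omega)
      simpa [add_assoc, add_comm 1 k] using this

theorem OccursAt.of_prefix {T x y : List α} {b : ℕ} (h : OccursAt T y b) (hxy : x <+: y) :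
    OccursAt T x b := by
  obtain ⟨u, v, hu, hT⟩ := h
  obtain ⟨z, rfl⟩ := hxy
  exact ⟨u, z ++ v, hu, by simp [hT]⟩

theorem OccursAt.of_suffix {T x y : List α} {b : ℕ} (h : OccursAt T y b) (hxy : x <:+ y) :
    OccursAt T x (b + (y.length - x.length)) := by
  obtain ⟨u, v, hu, hT⟩ := h
  obtain ⟨z, rfl⟩ := hxy
  exact ⟨u ++ z, v, by simp [hu], by simp [hT]⟩

theorem prefix_iff_occursAt {T x : List α} : x <+: T ↔ OccursAt T x 0 := by
  constructor
  · rintro ⟨v, h⟩; exact ⟨[], v, rfl, by simp [h]⟩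
  · rintro ⟨u, v, hu, h⟩
    obtain rfl := List.eq_nil_of_length_eq_zero hu
    exact ⟨v, by simp [h]⟩

theorem suffix_iff_occursAt {T x : List α} :
    x <:+ T ↔ ∃ b, OccursAt T x b ∧ T[b + x.length]? = none := by
  constructor
  · rintro ⟨u, h⟩
    refine ⟨u.length, ⟨u, [], rfl, by simp [h]⟩, ?_⟩
    rw [← h]; simp
  · rintro ⟨b, ⟨u, v, hu, h⟩, hn⟩
    rw [List.getElem?_eq_none_iff, h] at hn
    simp only [List.length_append] at hn
    obtain rfl := List.eq_nil_of_length_eq_zero (l := v) (by omega)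
    exact ⟨u, by simp [h]⟩

/-- The character to the left of position `b`, if there is one. -/
def leftChar (T : List α) (b : ℕ) : Option α := if b = 0 then none else T[b - 1]?

theorem leftChar_succ (T : List α) (b : ℕ) : leftChar T (b + 1) = T[b]? := by simp [leftChar]

theorem leftChar_of_pos {T : List α} {b : ℕ} (h : 0 < b) : leftChar T b = T[b - 1]? := by
  simp [leftChar]; omega

theorem cons_infix_iff {T x : List α} {a : α} :
    (a :: x) <:+: T ↔ ∃ b, OccursAt T x b ∧ leftChar T b = some a := by
  rw [infix_iff_exists_occursAt]
  constructor
  · rintro ⟨b, h⟩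
    rw [occursAt_cons] at h
    exact ⟨b + 1, h.1, by rw [leftChar_succ, h.2]⟩
  · rintro ⟨b, h, h'⟩
    rcases b with _ | b
    · simp [leftChar] at h'
    · exact ⟨b, occursAt_cons.2 ⟨h, by rwa [leftChar_succ] at h'⟩⟩

theorem append_singleton_infix_iff {T x : List α} {a : α} :
    (x ++ [a]) <:+: T ↔ ∃ b, OccursAt T x b ∧ T[b + x.length]? = some a := by
  simp only [infix_iff_exists_occursAt, occursAt_append_singleton]

theorem OccursAt.leftChar_ne_none {T x : List α} {b : ℕ} (h : OccursAt T x b) (hb : b ≠ 0) :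
    ∃ a, leftChar T b = some a := by
  have := h.le
  exact ⟨T[b - 1]'(by omega), by rw [leftChar_of_pos (by omega)]; simp⟩

/-! ### Characterisations of left- and right-maximality -/

theorem mem_LeftM_of_leftChar_ne {T x : List α} {b b' : ℕ} (h : OccursAt T x b)
    (h' : OccursAt T x b') (hne : leftChar T b ≠ leftChar T b') : x ∈ LeftM T := by
  refine ⟨h.isInfix, ?_⟩
  by_cases hb : b = 0
  · subst hb; exact Or.inr (prefix_iff_occursAt.2 h)
  by_cases hb' : b' = 0
  · subst hb'; exact Or.inr (prefix_iff_occursAt.2 h')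
  obtain ⟨a, ha⟩ := h.leftChar_ne_none hb
  obtain ⟨a', ha'⟩ := h'.leftChar_ne_none hb'
  exact Or.inl ⟨a, a', by rintro rfl; exact hne (ha.trans ha'.symm),
    cons_infix_iff.2 ⟨b, h, ha⟩, cons_infix_iff.2 ⟨b', h', ha'⟩⟩

theorem mem_LeftM_of_occursAt_zero {T x : List α} (h : OccursAt T x 0) : x ∈ LeftM T :=
  ⟨h.isInfix, Or.inr (prefix_iff_occursAt.2 h)⟩

theorem mem_RightM_of_ne {T x : List α} {b b' : ℕ} (h : OccursAt T x b)
    (h' : OccursAt T x b') (hne : T[b + x.length]? ≠ T[b' + x.length]?) : x ∈ RightM T := by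
  refine ⟨h.isInfix, ?_⟩
  cases hb : T[b + x.length]? with
  | none => exact Or.inr (suffix_iff_occursAt.2 ⟨b, h, hb⟩)
  | some a =>
    cases hb' : T[b' + x.length]? with
    | none => exact Or.inr (suffix_iff_occursAt.2 ⟨b', h', hb'⟩)
    | some a' =>
      exact Or.inl ⟨a, a', by rintro rfl; exact hne (hb.trans hb'.symm),
        append_singleton_infix_iff.2 ⟨b, h, hb⟩, append_singleton_infix_iff.2 ⟨b', h', hb'⟩⟩

theorem exists_leftChar_of_notMem_LeftM {T x : List α} (h : x <:+: T) (hx : x ∉ LeftM T) :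
    ∃ c, ∀ b, OccursAt T x b → leftChar T b = some c := by
  obtain ⟨b, hb⟩ := infix_iff_exists_occursAt.1 h
  have hb0 : b ≠ 0 := by rintro rfl; exact hx (mem_LeftM_of_occursAt_zero hb)
  obtain ⟨c, hc⟩ := hb.leftChar_ne_none hb0
  refine ⟨c, fun b' hb' => ?_⟩
  by_contra hne
  exact hx (mem_LeftM_of_leftChar_ne hb' hb (by rwa [hc]))

theorem exists_rightChar_of_notMem_RightM {T x : List α} (h : x <:+: T) (hx : x ∉ RightM T) :
    ∃ c, ∀ b, OccursAt T x b → T[b + x.length]? = some c := by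
  obtain ⟨b, hb⟩ := infix_iff_exists_occursAt.1 h
  cases hc : T[b + x.length]? with
  | none => exact absurd ⟨h, Or.inr (suffix_iff_occursAt.2 ⟨b, hb, hc⟩)⟩ hx
  | some c =>
    refine ⟨c, fun b' hb' => ?_⟩
    by_contra hne
    exact hx (mem_RightM_of_ne hb' hb (by rwa [hc]))

theorem exists_leftChar_ne {T x : List α} (hx : x ∈ LeftM T) (c : α) :
    ∃ b, OccursAt T x b ∧ leftChar T b ≠ some c := by
  rcases hx.2 with ⟨a, a', hne, h, h'⟩ | h
  · obtain ⟨b, hb, e⟩ := cons_infix_iff.1 h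
    obtain ⟨b', hb', e'⟩ := cons_infix_iff.1 h'
    by_cases hac : a = c
    · exact ⟨b', hb', by rw [e']; rintro ⟨⟩; exact hne hac⟩
    · exact ⟨b, hb, by rw [e]; rintro ⟨⟩; exact hac rfl⟩
  · exact ⟨0, prefix_iff_occursAt.1 h, by simp [leftChar]⟩

theorem exists_rightChar_ne {T x : List α} (hx : x ∈ RightM T) (c : α) :
    ∃ b, OccursAt T x b ∧ T[b + x.length]? ≠ some c := by
  rcases hx.2 with ⟨a, a', hne, h, h'⟩ | h
  · obtain ⟨b, hb, e⟩ := append_singleton_infix_iff.1 h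
    obtain ⟨b', hb', e'⟩ := append_singleton_infix_iff.1 h'
    by_cases hac : a = c
    · exact ⟨b', hb', by rw [e']; rintro ⟨⟩; exact hne hac⟩
    · exact ⟨b, hb, by rw [e]; rintro ⟨⟩; exact hac rfl⟩
  · obtain ⟨b, hb, e⟩ := suffix_iff_occursAt.1 h
    exact ⟨b, hb, by simp [e]⟩

theorem mem_LeftM_of_prefix {T x y : List α} (hy : y ∈ LeftM T) (h : x <+: y) : x ∈ LeftM T := by
  by_contra hx
  obtain ⟨c, hc⟩ := exists_leftChar_of_notMem_LeftM (h.isInfix.trans hy.1) hx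
  obtain ⟨b, hb, hne⟩ := exists_leftChar_ne hy c
  exact hne (hc b (hb.of_prefix h))

theorem mem_RightM_of_suffix {T x y : List α} (hy : y ∈ RightM T) (h : x <:+ y) :
    x ∈ RightM T := by
  by_contra hx
  obtain ⟨c, hc⟩ := exists_rightChar_of_notMem_RightM (h.isInfix.trans hy.1) hx
  obtain ⟨b, hb, hne⟩ := exists_rightChar_ne hy c
  have := hc _ (hb.of_suffix h)
  have hl := h.length_le
  rw [show b + (y.length - x.length) + x.length = b + y.length by omega] at this
  exact hne this

/-! ### Periods and overlapping occurrences -/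

/-- A consequence of the Fine–Wilf theorem at its critical length, proved by Euclid's algorithm: on
the shorter range left after removing the smaller period, the difference of the periods is again a
period. -/
theorem eq_of_two_periods {β : Type*} (f : ℕ → β) (n q r : ℕ) (hq : 0 < q) (hr : 0 < r)
    (hn : q + r ≤ n + 1) (pq : ∀ k, k + q < n → f k = f (k + q))
    (pr : ∀ k, k + r < n → f k = f (k + r)) : f (q - 1) = f (r - 1) := by
  induction hs : q + r using Nat.strong_induction_on generalizing n q r with
  | _ s ih =>
    rcases lt_trichotomy q r with h | h | h
    · have h1 := ih (q + (r - q)) (by omega) (n - q) q (r - q) hq (by omega) (by omega)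
        (fun k hk => pq k (by omega))
        (fun k hk => by
          rw [pr k (by omega), pq (k + (r - q)) (by omega)]; congr 1; omega) rfl
      rw [h1, pq (r - q - 1) (by omega)]; congr 1; omega
    · rw [h]
    · have h1 := ih ((q - r) + r) (by omega) (n - r) (q - r) r (by omega) hr (by omega)
        (fun k hk => by
          rw [pq k (by omega), pr (k + (q - r)) (by omega)]; congr 1; omega)
        (fun k hk => pr k (by omega)) rfl
      rw [← h1, pr (q - r - 1) (by omega)]; congr 1; omega

section Triple

variable {T x : List α} {b₁ b₂ b₃ : ℕ}

theorem period_of_occursAt {b b' k : ℕ} (h : OccursAt T x b) (h' : OccursAt T x b') (hb : b ≤ b')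
    (hk : k + (b' - b) < x.length) : x[k]? = x[k + (b' - b)]? := by
  rw [← (occursAt_iff.1 h').2 k (by omega), ← (occursAt_iff.1 h).2 _ hk]
  congr 1; omega

/-- The distances `b₂ - b₁` and `b₃ - b₂` are periods of `x`, and each of the two letters can be
read inside the next occurrence. The bound is sharp enough to include the case where the distances
add up to `|x| + 1`, which is where `eq_of_two_periods` is needed. -/
theorem rightChar_eq_of_three (h₁ : OccursAt T x b₁) (h₂ : OccursAt T x b₂) (h₃ : OccursAt T x b₃)
    (h12 : b₁ < b₂) (h23 : b₂ < b₃) (hn : b₃ ≤ b₁ + x.length + 1) :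
    T[b₁ + x.length]? = T[b₂ + x.length]? := by
  set n := x.length with hnx
  have e1 : T[b₁ + n]? = x[n - (b₂ - b₁)]? := by
    rw [← (occursAt_iff.1 h₂).2 _ (by omega)]; congr 1; omega
  have e2 : T[b₂ + n]? = x[n - (b₃ - b₂)]? := by
    rw [← (occursAt_iff.1 h₃).2 _ (by omega)]; congr 1; omega
  rw [e1, e2]
  by_cases hc : b₃ ≤ b₁ + n
  · have p1 := period_of_occursAt (k := n - (b₃ - b₁)) h₁ h₂ h12.le (by omega)
    have p2 := period_of_occursAt (k := n - (b₃ - b₁)) h₂ h₃ h23.le (by omega)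
    rw [show n - (b₂ - b₁) = n - (b₃ - b₁) + (b₃ - b₂) by omega, ← p2, p1]
    congr 1; omega
  · have := eq_of_two_periods (fun k => x[k]?) n (b₂ - b₁) (b₃ - b₂) (by omega) (by omega)
      (by omega) (fun k hk => period_of_occursAt h₁ h₂ h12.le hk)
      (fun k hk => period_of_occursAt h₂ h₃ h23.le hk)
    rw [show n - (b₂ - b₁) = b₃ - b₂ - 1 by omega, show n - (b₃ - b₂) = b₂ - b₁ - 1 by omega]
    exact this.symm

theorem leftChar_eq_of_three (h₁ : OccursAt T x b₁) (h₂ : OccursAt T x b₂) (h₃ : OccursAt T x b₃)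
    (h12 : b₁ < b₂) (h23 : b₂ < b₃) (hn : b₃ ≤ b₁ + x.length + 1) :
    leftChar T b₂ = leftChar T b₃ := by
  rw [leftChar_of_pos (by omega), leftChar_of_pos (by omega)]
  have e1 : T[b₂ - 1]? = x[b₂ - b₁ - 1]? := by
    rw [← (occursAt_iff.1 h₁).2 _ (by omega)]; congr 1; omega
  have e2 : T[b₃ - 1]? = x[b₃ - b₂ - 1]? := by
    rw [← (occursAt_iff.1 h₂).2 _ (by omega)]; congr 1; omega
  rw [e1, e2]
  exact eq_of_two_periods (fun k => x[k]?) x.length (b₂ - b₁) (b₃ - b₂) (by omega) (by omega)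
    (by omega) (fun k hk => period_of_occursAt h₁ h₂ h12.le hk)
    (fun k hk => period_of_occursAt h₂ h₃ h23.le hk)

end Triple

/-! ### Extending a substring to a maximal one -/

/-- `s` is a suffix of `u`, and each occurrence of `s` in `T` is the end of one of `u`. -/
def LeftExt (T s u : List α) : Prop :=
  s <:+ u ∧ ∀ b, OccursAt T s b → ∃ k, k + u.length = b + s.length ∧ OccursAt T u k

/-- `s` is a prefix of `u`, and each occurrence of `s` in `T` is the beginning of one of `u`. -/
def RightExt (T s u : List α) : Prop :=
  s <+: u ∧ ∀ b, OccursAt T s b → OccursAt T u b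

theorem exists_leftExt {T s : List α} (h : s <:+: T) : ∃ u ∈ LeftM T, LeftExt T s u := by
  obtain ⟨b, hb⟩ := infix_iff_exists_occursAt.1 h
  clear h
  induction b generalizing s with
  | zero => exact ⟨s, mem_LeftM_of_occursAt_zero hb, List.suffix_rfl, fun b hb => ⟨b, rfl, hb⟩⟩
  | succ b ih =>
    by_cases hs : s ∈ LeftM T
    · exact ⟨s, hs, List.suffix_rfl, fun b hb => ⟨b, rfl, hb⟩⟩
    · obtain ⟨c, hc⟩ := exists_leftChar_of_notMem_LeftM hb.isInfix hs
      obtain ⟨u, hu, hsu, hext⟩ :=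
        ih (s := c :: s) (occursAt_cons.2 ⟨hb, by rw [← leftChar_succ, hc _ hb]⟩)
      refine ⟨u, hu, (List.suffix_cons c s).trans hsu, fun b' hb' => ?_⟩
      have h' := hc b' hb'
      rcases b' with _ | b'
      · simp [leftChar] at h'
      · obtain ⟨b'', e, ho⟩ := hext b' (occursAt_cons.2 ⟨hb', by rwa [leftChar_succ] at h'⟩)
        exact ⟨b'', by rw [e, List.length_cons]; omega, ho⟩

theorem exists_rightExt {T s : List α} (h : s <:+: T) : ∃ u ∈ RightM T, RightExt T s u := by
  obtain ⟨b, hb⟩ := infix_iff_exists_occursAt.1 h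
  clear h
  induction hk : T.length - (b + s.length) using Nat.strong_induction_on generalizing s with
  | _ k ih =>
    by_cases hs : s ∈ RightM T
    · exact ⟨s, hs, List.prefix_rfl, fun b hb => hb⟩
    · obtain ⟨c, hc⟩ := exists_rightChar_of_notMem_RightM hb.isInfix hs
      have hl := (List.getElem?_eq_some_iff.1 (hc b hb)).1
      obtain ⟨u, hu, hsu, hext⟩ := ih (T.length - (b + (s ++ [c]).length))
        (by simp; omega) (s := s ++ [c]) (occursAt_append_singleton.2 ⟨hb, hc b hb⟩) rfl
      exact ⟨u, hu, (List.prefix_append s [c]).trans hsu,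
        fun b' hb' => hext b' (occursAt_append_singleton.2 ⟨hb', hc b' hb'⟩)⟩

theorem LeftExt.mem_RightM {T s u : List α} (h : LeftExt T s u) (hs : s ∈ RightM T) :
    u ∈ RightM T := by
  have hu : u <:+: T := by
    obtain ⟨b, hb⟩ := infix_iff_exists_occursAt.1 hs.1
    obtain ⟨b', _, h'⟩ := h.2 b hb
    exact h'.isInfix
  by_contra hn
  obtain ⟨c, hc⟩ := exists_rightChar_of_notMem_RightM hu hn
  obtain ⟨b, hb, hne⟩ := exists_rightChar_ne hs c
  obtain ⟨b', e, h'⟩ := h.2 b hb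
  exact hne (by rw [← e, hc b' h'])

theorem RightExt.mem_LeftM {T s u : List α} (h : RightExt T s u) (hs : s ∈ LeftM T) :
    u ∈ LeftM T := by
  have hu : u <:+: T := by
    obtain ⟨b, hb⟩ := infix_iff_exists_occursAt.1 hs.1
    exact (h.2 b hb).isInfix
  by_contra hn
  obtain ⟨c, hc⟩ := exists_leftChar_of_notMem_LeftM hu hn
  obtain ⟨b, hb, hne⟩ := exists_leftChar_ne hs c
  exact hne (hc b (h.2 b hb))

/-- A shorter left-maximal `v` ending in `s` would have an occurrence preceded by a letter other
than the one in `u`, although `s` always extends to `u`. -/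
theorem LeftExt.isLeftRep {T s u : List α} (h : LeftExt T s u) (hu : u ∈ LeftM T) :
    IsLeftRep T s u := by
  refine ⟨hu, h.1, fun v hv hsv => ?_⟩
  by_contra hlt
  push Not at hlt
  have hsl := hsv.length_le
  obtain ⟨b, hb, hne⟩ := exists_leftChar_ne hv (u[u.length - v.length - 1]'(by omega))
  obtain ⟨b', e, h'⟩ := h.2 _ (hb.of_suffix hsv)
  apply hne
  rw [leftChar_of_pos (by omega), show b - 1 = b' + (u.length - v.length - 1) by omega,
    (occursAt_iff.1 h').2 _ (by omega)]
  simp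

theorem LeftExt.eq_of_isLeftRep {T s u v : List α} (h : LeftExt T s u) (hu : u ∈ LeftM T)
    (hv : IsLeftRep T s v) : u = v := by
  have h1 := (h.isLeftRep hu).2.2 v hv.1 hv.2.1
  have h2 := hv.2.2 u hu h.1
  obtain ⟨b, hb⟩ := infix_iff_exists_occursAt.1 hv.1.1
  obtain ⟨b', e, h'⟩ := h.2 _ (hb.of_suffix hv.2.1)
  have := hv.2.1.length_le
  obtain rfl : b' = b := by omega
  exact h'.eq_of_length_eq hb (by omega)

/-- Infinite descent: an occurrence of `u` ends with `s₂`, which begins with `s₁`; if `s₁` is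
shorter, the copy of `u` forced by this `s₁` starts strictly further left. -/
theorem LeftExt.eq_of_prefix {T s₁ s₂ u : List α} (h : LeftExt T s₁ u) (hu : u <:+: T)
    (h₂ : s₂ <:+ u) (h₁₂ : s₁ <+: s₂) : s₁ = s₂ := by
  by_contra hne
  have hlt : s₁.length < s₂.length :=
    lt_of_le_of_ne h₁₂.length_le fun e => hne (h₁₂.eq_of_length e)
  have key : ∀ b, ¬ OccursAt T u b := by
    intro b
    induction b using Nat.strong_induction_on with
    | _ b ih =>
      intro hb
      obtain ⟨b', e, h'⟩ := h.2 _ ((hb.of_suffix h₂).of_prefix h₁₂)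
      have := h₂.length_le
      exact ih b' (by omega) h'
  obtain ⟨b, hb⟩ := infix_iff_exists_occursAt.1 hu
  exact key b hb

theorem RightExt.eq_of_suffix {T s₁ s₂ u : List α} (h : RightExt T s₁ u) (hu : u <:+: T)
    (h₂ : s₂ <+: u) (h₁₂ : s₁ <:+ s₂) : s₁ = s₂ := by
  by_contra hne
  have hlt : s₁.length < s₂.length :=
    lt_of_le_of_ne h₁₂.length_le fun e => hne (h₁₂.eq_of_length e)
  have key : ∀ k b, T.length - b = k → ¬ OccursAt T u b := by
    intro k
    induction k using Nat.strong_induction_on with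
    | _ k ih =>
      intro b hk hb
      have h' := h.2 _ ((hb.of_prefix h₂).of_suffix h₁₂)
      have := h'.le
      exact ih _ (by omega) _ rfl h'
  obtain ⟨b, hb⟩ := infix_iff_exists_occursAt.1 hu
  exact key _ b rfl hb

/-! ### Degrees -/

theorem finite_substrings (T : List α) : {x | x <:+: T}.Finite :=
  (List.finite_toSet T.sublists).subset fun _ hx => List.mem_sublists.2 hx.sublist

theorem finite_MaxSub (T : List α) : (MaxSub T).Finite :=
  (finite_substrings T).subset fun _ hx => hx.1.1

/-- The characters that follow an occurrence of `x` in `T`. -/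
def rightSet (T x : List α) : Set α := {a | (x ++ [a]) <:+: T}

theorem finite_rightSet (T x : List α) : (rightSet T x).Finite :=
  (List.finite_toSet T).subset fun a ha => ha.subset (by simp)

/-- The number of characters that follow an occurrence of `x` in `T`. -/
noncomputable def rdeg (T x : List α) : ℕ := (rightSet T x).ncard

theorem rightSet_subset_of_suffix {T s u : List α} (h : s <:+ u) : rightSet T u ⊆ rightSet T s := by
  intro a ha
  obtain ⟨z, rfl⟩ := h
  have : s ++ [a] <:+: z ++ s ++ [a] := ⟨z, [], by simp⟩
  exact this.trans ha

theorem rdeg_le_of_suffix {T s u : List α} (h : s <:+ u) : rdeg T u ≤ rdeg T s :=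
  Set.ncard_le_ncard (rightSet_subset_of_suffix h) (finite_rightSet T s)

theorem LeftExt.rightSet_eq {T s u : List α} (h : LeftExt T s u) :
    rightSet T s = rightSet T u := by
  refine Set.Subset.antisymm (fun a ha => ?_) (rightSet_subset_of_suffix h.1)
  obtain ⟨b, hb, hc⟩ := append_singleton_infix_iff.1 ha
  obtain ⟨b', e, h'⟩ := h.2 b hb
  exact append_singleton_infix_iff.2 ⟨b', h', by rw [e, hc]⟩

theorem prefix_or_prefix_or_diverge (x y : List α) :
    x <+: y ∨ y <+: x ∨ ∃ g a b, a ≠ b ∧ (g ++ [a]) <+: x ∧ (g ++ [b]) <+: y := by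
  induction x generalizing y with
  | nil => exact Or.inl List.nil_prefix
  | cons a x ih =>
    rcases y with _ | ⟨b, y⟩
    · exact Or.inr (Or.inl List.nil_prefix)
    · by_cases hab : a = b
      · subst hab
        rcases ih y with h | h | ⟨g, c, d, hcd, h1, h2⟩
        · exact Or.inl (List.cons_prefix_cons.2 ⟨rfl, h⟩)
        · exact Or.inr (Or.inl (List.cons_prefix_cons.2 ⟨rfl, h⟩))
        · exact Or.inr (Or.inr ⟨a :: g, c, d, hcd, List.cons_prefix_cons.2 ⟨rfl, h1⟩,
            List.cons_prefix_cons.2 ⟨rfl, h2⟩⟩)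
      · exact Or.inr (Or.inr ⟨[], a, b, hab, by simp, by simp⟩)

theorem edges_finite (T : List α) : (edges T).Finite := by
  refine ((finite_substrings T).prod ((finite_substrings T).prod (finite_substrings T))).subset ?_
  rintro ⟨x, β, y⟩ ⟨hx, hy, _, h, _, _⟩
  have : β <:+: x ++ β := (List.suffix_append x β).isInfix
  exact ⟨hx.1.1, this.trans h.1, hy.1.1⟩

/-- Where two labels with the same first letter diverge, the common part is already branching, hence
right-maximal, against the minimality of the labels. -/
theorem edge_label_unique {T x β β' : List α} (hβ : β ≠ [])
    (hh : β.head? = β'.head?) (h : x ++ β ∈ RightM T) (h' : x ++ β' ∈ RightM T)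
    (hm : ∀ γ : List α, γ ≠ [] → γ <+: β → γ ≠ β → x ++ γ ∉ RightM T)
    (hm' : ∀ γ : List α, γ ≠ [] → γ <+: β' → γ ≠ β' → x ++ γ ∉ RightM T) : β = β' := by
  have hβ' : β' ≠ [] := by rintro rfl; simp at hh; exact hβ hh
  rcases prefix_or_prefix_or_diverge β β' with hp | hp | ⟨g, a, b, hab, h1, h2⟩
  · by_contra hne
    exact hm' β hβ hp hne h
  · by_contra hne
    exact hm β' hβ' hp (Ne.symm hne) h'
  · have hg : g ≠ [] := by
      rintro rfl
      obtain ⟨z, rfl⟩ := h1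
      obtain ⟨z', rfl⟩ := h2
      simp at hh; exact hab hh
    refine absurd ?_ (hm g hg ((List.prefix_append g [a]).trans h1) ?_)
    · have e1 : x ++ g ++ [a] <:+: T := by
        rw [List.append_assoc]
        exact ((List.prefix_append_right_inj x).2 h1).isInfix.trans h.1
      have e2 : x ++ g ++ [b] <:+: T := by
        rw [List.append_assoc]
        exact ((List.prefix_append_right_inj x).2 h2).isInfix.trans h'.1
      exact ⟨(List.prefix_append (x ++ g) [a]).isInfix.trans e1, Or.inl ⟨a, b, hab, e1, e2⟩⟩
    · rintro rfl
      have := h1.length_le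
      simp at this

/-- An edge is determined by the first letter of its label. Conversely, the right extension of `x ++
[a]` followed by the left extension gives the edge beginning with `a`. -/
theorem outDeg_eq_rdeg {T x : List α} (hx : x ∈ MaxSub T) : outDeg T x = rdeg T x := by
  unfold outDeg rdeg
  refine Set.ncard_congr (fun p hp => p.2.1.head hp.1.2.2.1) ?_ ?_ ?_
  · rintro ⟨x', β, y⟩ ⟨⟨h1, h2, h3, h4, h5, h6⟩, rfl⟩
    dsimp only at *
    have : x' ++ [β.head h3] <+: x' ++ β := by
      refine (List.prefix_append_right_inj x').2 ?_
      obtain ⟨a, l, rfl⟩ := List.exists_cons_of_ne_nil h3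
      simp
    exact this.isInfix.trans h4.1
  · rintro ⟨x₁, β₁, y₁⟩ ⟨x₂, β₂, y₂⟩ ⟨⟨h1, h2, h3, h4, h5, h6⟩, e⟩
      ⟨⟨h1', h2', h3', h4', h5', h6'⟩, e'⟩ hh
    have hh' : β₁.head? = β₂.head? := by
      rw [List.head?_eq_some_head h3, List.head?_eq_some_head h3']
      exact congrArg some hh
    clear hh
    obtain rfl : x₁ = x₂ := e.trans e'.symm
    obtain rfl : β₁ = β₂ := edge_label_unique h3 hh' h4 h4' h5 h5'
    obtain ⟨u, hu, hext⟩ := exists_leftExt h4.1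
    obtain rfl : y₁ = y₂ := (hext.eq_of_isLeftRep hu h6).symm.trans (hext.eq_of_isLeftRep hu h6')
    rfl
  · intro a ha
    obtain ⟨u, hu, hpre, hext⟩ := exists_rightExt (T := T) (s := x ++ [a]) ha
    obtain ⟨z, rfl⟩ := hpre
    obtain ⟨y, hy, hyext⟩ := exists_leftExt hu.1
    refine ⟨(x, a :: z, y), ⟨⟨hx, ⟨hy, hyext.mem_RightM hu⟩, by simp, by simpa using hu, ?_, ?_⟩,
      rfl⟩, by simp⟩
    · rintro γ hγ hγp hγne hγR
      dsimp only at *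
      obtain ⟨t, ht⟩ := hγp
      rcases γ with _ | ⟨a', γ⟩
      · exact hγ rfl
      · simp only [List.cons_append, List.cons.injEq] at ht
        obtain ⟨rfl, rfl⟩ := ht
        rcases t with _ | ⟨c, t⟩
        · simp at hγne
        · obtain ⟨b, hb, hne⟩ := exists_rightChar_ne hγR c
          have h1 : OccursAt T (x ++ [a']) b := hb.of_prefix ⟨γ, by simp⟩
          have h2 : OccursAt T (x ++ a' :: γ ++ [c]) b := (hext b h1).of_prefix ⟨t, by simp⟩
          exact hne (occursAt_append_singleton.1 h2).2
    · simpa using hyext.isLeftRep hy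

theorem outDeg_le_rdeg (T x : List α) : outDeg T x ≤ rdeg T x := by
  by_cases hx : x ∈ MaxSub T
  · exact (outDeg_eq_rdeg hx).le
  · have : {p ∈ edges T | p.1 = x} = ∅ := by
      ext p
      simp only [Set.mem_ofPred_eq, Set.mem_empty_iff_false, iff_false, not_and]
      rintro hp rfl
      exact hx hp.1
    simp [outDeg, this]

theorem size_eq_sum (T : List α) : size T = ∑ x ∈ (finite_MaxSub T).toFinset, rdeg T x := by
  classical
  unfold size
  rw [Set.ncard_eq_toFinset_card _ (edges_finite T),
    Finset.card_eq_sum_card_fiberwise (f := fun p => p.1) (t := (finite_MaxSub T).toFinset)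
      (fun p hp => by
        simp only [Finset.mem_coe, Set.Finite.mem_toFinset] at hp ⊢
        exact hp.1)]
  refine Finset.sum_congr rfl fun x hx => ?_
  rw [← outDeg_eq_rdeg ((Set.Finite.mem_toFinset _).1 hx)]
  unfold outDeg
  rw [← Set.ncard_coe_finset]
  congr 1
  ext p
  simp

/-! ### Chains of one-sided maximal substrings -/

theorem nil_mem_MaxSub (T : List α) : [] ∈ MaxSub T :=
  ⟨⟨List.nil_infix, Or.inr List.nil_prefix⟩, List.nil_infix, Or.inr List.nil_suffix⟩

theorem self_mem_MaxSub (T : List α) : T ∈ MaxSub T :=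
  ⟨⟨List.infix_rfl, Or.inr List.prefix_rfl⟩, List.infix_rfl, Or.inr List.suffix_rfl⟩

theorem ncard_MaxSub (T : List α) : (MaxSub T).ncard = (MR T).ncard + 1 :=
  (Set.ncard_sdiff_singleton_add_one (self_mem_MaxSub T) (finite_MaxSub T)).symm

/-- The map to left extensions is injective on the chain by `LeftExt.eq_of_prefix` and preserves the
letters that follow. Its values are nodes, and not `T`, because something follows them. -/
theorem card_and_sum_le_of_prefix_chain {ι : Type*} (T : List α) (A : Finset ι) (f : ι → List α)
    (hinj : Set.InjOn f A) (hchain : ∀ a ∈ A, ∀ b ∈ A, f a <+: f b ∨ f b <+: f a)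
    (hR : ∀ a ∈ A, f a ∈ RightM T) (hfol : ∀ a ∈ A, ∃ c, (f a ++ [c]) <:+: T) :
    A.card ≤ (MR T).ncard ∧ ∑ a ∈ A, rdeg T (f a) ≤ size T := by
  classical
  have hex : ∀ a, ∃ u, a ∈ A → u ∈ LeftM T ∧ LeftExt T (f a) u := fun a => by
    by_cases ha : a ∈ A
    · obtain ⟨u, hu, h⟩ := exists_leftExt (hR a ha).1
      exact ⟨u, fun _ => ⟨hu, h⟩⟩
    · exact ⟨[], fun h => absurd h ha⟩
  choose g hg using hex
  have hgM : ∀ a ∈ A, g a ∈ MaxSub T := fun a ha =>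
    ⟨(hg a ha).1, (hg a ha).2.mem_RightM (hR a ha)⟩
  have hginj : Set.InjOn g A := by
    intro a ha b hb hab
    apply hinj ha hb
    have h1 := hg a ha
    have h2 := hg b hb
    rcases hchain a ha b hb with h | h
    · exact h1.2.eq_of_prefix h1.1.1 (hab ▸ h2.2.1) h
    · exact (h2.2.eq_of_prefix h2.1.1 (hab ▸ h1.2.1) h).symm
  have hgMR : ∀ a ∈ A, g a ∈ MR T := by
    intro a ha
    refine ⟨hgM a ha, ?_⟩
    rintro (hT : g a = T)
    obtain ⟨c, hc⟩ := hfol a ha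
    have : c ∈ rightSet T (g a) := by rw [← (hg a ha).2.rightSet_eq]; exact hc
    have hl := List.IsInfix.length_le this
    rw [hT] at hl
    simp at hl
  constructor
  · have hfin : (MR T).Finite := (finite_MaxSub T).subset Set.sdiff_subset
    rw [Set.ncard_eq_toFinset_card _ hfin]
    exact Finset.card_le_card_of_injOn g (fun a ha => by simpa using hgMR a ha) hginj
  · rw [size_eq_sum, Finset.sum_congr rfl fun a ha =>
      show rdeg T (f a) = rdeg T (g a) by rw [rdeg, rdeg, (hg a ha).2.rightSet_eq],
      ← Finset.sum_image (g := g) hginj]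
    refine Finset.sum_le_sum_of_subset ?_
    intro u hu
    obtain ⟨a, ha, rfl⟩ := Finset.mem_image.1 hu
    simpa using hgM a ha

/-- The mirror image, with right extensions. Two occurrences are what excludes the value `T`, which
occurs only once in itself. -/
theorem card_le_of_suffix_chain {ι : Type*} (T : List α) (A : Finset ι) (f : ι → List α)
    (hinj : Set.InjOn f A) (hchain : ∀ a ∈ A, ∀ b ∈ A, f a <:+ f b ∨ f b <:+ f a)
    (hL : ∀ a ∈ A, f a ∈ LeftM T) :
    A.card ≤ (MR T).ncard + 1 ∧
      ((∀ a ∈ A, ∃ b b', b ≠ b' ∧ OccursAt T (f a) b ∧ OccursAt T (f a) b') →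
        A.card ≤ (MR T).ncard) := by
  classical
  have hex : ∀ a, ∃ u, a ∈ A → u ∈ RightM T ∧ RightExt T (f a) u := fun a => by
    by_cases ha : a ∈ A
    · obtain ⟨u, hu, h⟩ := exists_rightExt (hL a ha).1
      exact ⟨u, fun _ => ⟨hu, h⟩⟩
    · exact ⟨[], fun h => absurd h ha⟩
  choose g hg using hex
  have hgM : ∀ a ∈ A, g a ∈ MaxSub T := fun a ha =>
    ⟨(hg a ha).2.mem_LeftM (hL a ha), (hg a ha).1⟩
  have hginj : Set.InjOn g A := by
    intro a ha b hb hab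
    apply hinj ha hb
    have h1 := hg a ha
    have h2 := hg b hb
    rcases hchain a ha b hb with h | h
    · exact h1.2.eq_of_suffix h1.1.1 (hab ▸ h2.2.1) h
    · exact (h2.2.eq_of_suffix h2.1.1 (hab ▸ h1.2.1) h).symm
  constructor
  · rw [← ncard_MaxSub, Set.ncard_eq_toFinset_card _ (finite_MaxSub T)]
    exact Finset.card_le_card_of_injOn g (fun a ha => by simpa using hgM a ha) hginj
  · intro h2
    have hfin : (MR T).Finite := (finite_MaxSub T).subset Set.sdiff_subset
    rw [Set.ncard_eq_toFinset_card _ hfin]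
    refine Finset.card_le_card_of_injOn g (fun a ha => ?_) hginj
    simp only [Finset.mem_coe, Set.Finite.mem_toFinset]
    refine ⟨hgM a ha, ?_⟩
    rintro (hT : g a = T)
    obtain ⟨b, b', hne, hb, hb'⟩ := h2 a ha
    have e1 := ((hg a ha).2.2 b hb).le
    have e2 := ((hg a ha).2.2 b' hb').le
    rw [hT] at e1 e2
    omega

/-! ### Edited texts -/

/-- `T'` has the same first `i` characters as `T`, and the part of `T'` from `off ∈ {i, i + 1}` on is
the part of `T` from `j` on. -/
structure Edited (T T' : List α) (i off j : ℕ) : Prop where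
  le_off : i ≤ off
  off_le : off ≤ i + 1
  le_j : i ≤ j
  left_le : i ≤ T.length
  off_le_length : off ≤ T'.length
  length_eq : j + (T'.length - off) = T.length
  left : ∀ k < i, T[k]? = T'[k]?
  right : ∀ k, T[j + k]? = T'[off + k]?

/-- The pair `(off, j)` is `(i + 1, i)` for an insertion, `(i + 1, i + 1)` for a substitution and
`(i, i + 1)` for a deletion; from here on the three kinds are treated together. -/
theorem exists_edited {κ : EditKind} {i : ℕ} {T T' : List α} (h : IsEdit κ i T T') :
    ∃ off j, Edited T T' i off j ∧
      ∀ b e, b < e → (Crosses κ i b e ↔ i ≤ e ∧ b ≤ off) := by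
  cases κ with
  | insertion =>
    obtain ⟨p, s, c, rfl, rfl, rfl⟩ := h
    refine ⟨p.length + 1, p.length, ⟨by omega, by omega, by omega, by simp, by simp,
      by simp; omega, fun k hk => ?_, fun k => ?_⟩, fun b e hbe => ?_⟩
    · rw [List.getElem?_append_left hk, List.getElem?_append_left hk]
    · rw [List.getElem?_append_right (by omega), List.getElem?_append_right (by omega)]
      rw [show p.length + 1 + k - p.length = k + 1 by omega]; simp
    · simp only [Crosses]; omega
  | substitution =>
    obtain ⟨p, s, c, d, _, rfl, rfl, rfl⟩ := h
    refine ⟨p.length + 1, p.length + 1, ⟨by omega, by omega, by omega, by simp, by simp,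
      by simp, fun k hk => ?_, fun k => ?_⟩, fun b e hbe => ?_⟩
    · rw [List.getElem?_append_left hk, List.getElem?_append_left hk]
    · rw [List.getElem?_append_right (by omega), List.getElem?_append_right (by omega)]
      rw [show p.length + 1 + k - p.length = k + 1 by omega]; simp
    · simp only [Crosses]; omega
  | deletion =>
    obtain ⟨p, s, d, rfl, rfl, rfl⟩ := h
    refine ⟨p.length, p.length + 1, ⟨by omega, by omega, by omega, by simp, by simp,
      by simp; omega, fun k hk => ?_, fun k => ?_⟩, fun b e hbe => ?_⟩
    · rw [List.getElem?_append_left hk, List.getElem?_append_left hk]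
    · rw [List.getElem?_append_right (by omega), List.getElem?_append_right (by omega)]
      rw [show p.length + 1 + k - p.length = k + 1 by omega]; simp
    · simp only [Crosses]; omega

section

variable {T T' x y : List α} {i off j b : ℕ}

namespace Edited

theorem occ_left (h : Edited T T' i off j) (hx : OccursAt T' x b) (hb : b + x.length ≤ i) :
    OccursAt T x b := by
  rw [occursAt_iff] at hx ⊢
  have := h.left_le
  exact ⟨by omega, fun k hk => by rw [h.left _ (by omega), hx.2 k hk]⟩

theorem occ_right (h : Edited T T' i off j) (hx : OccursAt T' x b) (hb : off ≤ b) :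
    OccursAt T x (j + (b - off)) := by
  rw [occursAt_iff] at hx ⊢
  have := h.length_eq
  have := h.off_le_length
  refine ⟨by omega, fun k hk => ?_⟩
  rw [add_assoc, h.right, ← hx.2 k hk]
  congr 1; omega

theorem leftChar_left (h : Edited T T' i off j) (hb : b ≤ i) : leftChar T b = leftChar T' b := by
  unfold leftChar
  split_ifs
  · rfl
  · exact h.left _ (by omega)

theorem leftChar_right (h : Edited T T' i off j) (hb : off < b) :
    leftChar T (j + (b - off)) = leftChar T' b := by
  rw [leftChar_of_pos (by omega), leftChar_of_pos (by omega),
    show j + (b - off) - 1 = j + (b - off - 1) by omega, h.right]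
  congr 1; omega

theorem rightChar_right (h : Edited T T' i off j) {n : ℕ} (hb : off ≤ b) :
    T[j + (b - off) + n]? = T'[b + n]? := by
  rw [add_assoc, h.right]; congr 1; omega

theorem straddles (h : Edited T T' i off j) (hx : OccursAt T' x b) (hn : ¬ x <:+: T) :
    b < off ∧ i < b + x.length := by
  constructor
  · by_contra hb
    exact hn (h.occ_right hx (by omega)).isInfix
  · by_contra hb
    exact hn (h.occ_left hx (by omega)).isInfix

end Edited

/-! ### Crossing occurrences and periodicity -/

/-- The beginnings of the occurrences of `x` in `T'` that meet or touch the edited position. -/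
def cr (i off : ℕ) (T' x : List α) : Set ℕ := {b | OccursAt T' x b ∧ i ≤ b + x.length ∧ b ≤ off}

/-- The leftmost element of `cr`; the rightmost one is `hi`. -/
noncomputable def lo (i off : ℕ) (T' x : List α) : ℕ := sInf (cr i off T' x)

noncomputable def hi (i off : ℕ) (T' x : List α) : ℕ := sSup (cr i off T' x)

theorem bddAbove_cr : BddAbove (cr i off T' x) := ⟨off, fun _ hb => hb.2.2⟩

theorem lo_mem (h : (cr i off T' x).Nonempty) : lo i off T' x ∈ cr i off T' x := Nat.sInf_mem h

theorem hi_mem (h : (cr i off T' x).Nonempty) : hi i off T' x ∈ cr i off T' x :=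
  Nat.sSup_mem h bddAbove_cr

theorem lo_le (h : b ∈ cr i off T' x) : lo i off T' x ≤ b := Nat.sInf_le h

theorem le_hi (h : b ∈ cr i off T' x) : b ≤ hi i off T' x := le_csSup bddAbove_cr h

namespace Edited

/-- Crossing means `b + |x| ≥ i` and `b ≤ off ≤ i + 1`, so `hi - lo ≤ |x| + 1` and the lemma on
three occurrences applies to `lo < b < hi`. -/
theorem rightChar_eq_lo (h : Edited T T' i off j) (hb : b ∈ cr i off T' x)
    (hlt : b < hi i off T' x) : T'[b + x.length]? = T'[lo i off T' x + x.length]? := by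
  rcases (lo_le hb).eq_or_lt with e | hlt'
  · rw [e]
  · have h1 := lo_mem ⟨b, hb⟩
    have h3 := hi_mem ⟨b, hb⟩
    have := h.off_le
    exact (rightChar_eq_of_three h1.1 hb.1 h3.1 hlt' hlt (by have := h1.2; have := h3.2; omega)).symm

theorem leftChar_eq_hi (h : Edited T T' i off j) (hb : b ∈ cr i off T' x)
    (hlt : lo i off T' x < b) : leftChar T' b = leftChar T' (hi i off T' x) := by
  rcases (le_hi hb).eq_or_lt with e | hlt'
  · rw [e]
  · have h1 := lo_mem ⟨b, hb⟩
    have h3 := hi_mem ⟨b, hb⟩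
    have := h.off_le
    exact leftChar_eq_of_three h1.1 hb.1 h3.1 hlt hlt' (by have := h1.2; have := h3.2; omega)

/-- An occurrence that stays in the unchanged prefix, or starts beyond `off`, is carried to `T`
together with its left letter, which is then `c`. -/
theorem exists_newLeft (h : Edited T T' i off j) {c : α}
    (hc : ∀ b, OccursAt T x b → leftChar T b = some c) (hx : x ∈ LeftM T') :
    ∃ b ∈ cr i off T' x, i < b + x.length ∧ leftChar T' b ≠ some c := by
  obtain ⟨b, hb, hne⟩ := exists_leftChar_ne hx c
  have h1 : i < b + x.length := by
    by_contra hle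
    exact hne (by rw [← h.leftChar_left (by omega), hc _ (h.occ_left hb (by omega))])
  have h2 : b ≤ off := by
    by_contra hle
    exact hne (by rw [← h.leftChar_right (by omega), hc _ (h.occ_right hb (by omega))])
  exact ⟨b, ⟨hb, by omega, h2⟩, h1, hne⟩

theorem newLeft_lo_or_hi (h : Edited T T' i off j) {c : α}
    (hc : ∀ b, OccursAt T x b → leftChar T b = some c) (hx : x ∈ LeftM T') :
    (cr i off T' x).Nonempty ∧ (leftChar T' (lo i off T' x) ≠ some c ∨
      leftChar T' (hi i off T' x) ≠ some c) := by
  obtain ⟨b, hb, _, hne⟩ := h.exists_newLeft hc hx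
  refine ⟨⟨b, hb⟩, ?_⟩
  rcases (lo_le hb).eq_or_lt with e | hlt
  · exact Or.inl (by rwa [e])
  · exact Or.inr (by rwa [← h.leftChar_eq_hi hb hlt])

theorem lt_of_newLeft (h : Edited T T' i off j) {c : α}
    (hc : ∀ b, OccursAt T x b → leftChar T b = some c) (hb : b ∈ cr i off T' x)
    (hx : x ≠ []) (hne : leftChar T' b ≠ some c) : i < b + x.length := by
  by_contra hle
  have := List.length_pos_iff.2 hx
  exact hne (by rw [← h.leftChar_left (by omega), hc _ (h.occ_left hb.1 (by omega))])

end Edited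

/-- An occurrence of `x` that ends where one of a longer substring of `T` ends is preceded by a
character that precedes `x` in `T`. -/
theorem leftChar_of_shared_end {b b' : ℕ} {c : α}
    (hc : ∀ b, OccursAt T x b → leftChar T b = some c) (hx : OccursAt T' x b)
    (hy : OccursAt T' y b') (hyT : y <:+: T) (he : b + x.length = b' + y.length)
    (hlt : x.length < y.length) : leftChar T' b = some c := by
  obtain ⟨q, hq⟩ := infix_iff_exists_occursAt.1 hyT
  have ag := hy.agree hq
  have hxT : OccursAt T x (q + (y.length - x.length)) := by
    rw [occursAt_iff] at hx ⊢
    have := hq.le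
    refine ⟨by omega, fun k hk => ?_⟩
    rw [add_assoc, ← ag _ (by omega), ← hx.2 k hk]
    congr 1; omega
  have h1 := hc _ hxT
  rw [leftChar_of_pos (by omega)] at h1 ⊢
  rw [← h1, show q + (y.length - x.length) - 1 = q + (y.length - x.length - 1) by omega,
    ← ag _ (by omega)]
  congr 1; omega

/-! ### Counting by ends and by starts of windows -/

theorem win_prefix_win {e e' : ℕ} (h : e ≤ e') : win T b e <+: win T b e' := by
  unfold win
  exact ((List.take_prefix_take_left h).drop b)

theorem win_suffix_win {b' e : ℕ} (h : b ≤ b') : win T b' e <:+ win T b e := by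
  unfold win
  rw [show b' = b + (b' - b) by omega, ← List.drop_drop]
  exact List.drop_suffix _ _

theorem Edited.card_and_sum_le_of_ends (h : Edited T T' i off j) {ι : Type*} (A : Finset ι)
    (e : ι → ℕ) (hinj : Set.InjOn e A) (hoff : ∀ a ∈ A, off ≤ e a)
    (hR : ∀ a ∈ A, win T' off (e a) ∈ RightM T) (hfol : ∀ a ∈ A, ∃ c, T'[e a]? = some c) :
    A.card ≤ (MR T).ncard ∧ ∑ a ∈ A, rdeg T (win T' off (e a)) ≤ size T := by
  have hle : ∀ a ∈ A, e a < T'.length := fun a ha => by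
    obtain ⟨c, hc⟩ := hfol a ha
    exact (List.getElem?_eq_some_iff.1 hc).1
  refine card_and_sum_le_of_prefix_chain T A (fun a => win T' off (e a)) ?_ ?_ hR ?_
  · intro a ha b hb hab
    apply hinj ha hb
    have := congrArg List.length hab
    dsimp only at this
    rw [length_win (hle a ha).le, length_win (hle b hb).le] at this
    have := hoff a ha
    have := hoff b hb
    omega
  · intro a _ b _
    rcases le_total (e a) (e b) with h | h
    · exact Or.inl (win_prefix_win h)
    · exact Or.inr (win_prefix_win h)
  · intro a ha
    obtain ⟨c, hc⟩ := hfol a ha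
    refine ⟨c, (h.occ_right (b := off) (occursAt_append_singleton.2
      ⟨occursAt_win (hoff a ha) (hle a ha).le, ?_⟩) le_rfl).isInfix⟩
    rw [length_win (hle a ha).le, show off + (e a - off) = e a by have := hoff a ha; omega, hc]

theorem Edited.card_le_of_starts (h : Edited T T' i off j) {ι : Type*} (A : Finset ι)
    (s : ι → ℕ) (hinj : Set.InjOn s A) (hi : ∀ a ∈ A, s a ≤ i)
    (hL : ∀ a ∈ A, win T' (s a) i ∈ LeftM T) :
    A.card ≤ (MR T).ncard + 1 ∧
      ((∀ a ∈ A, ∃ b b', b ≠ b' ∧ OccursAt T (win T' (s a) i) b ∧ OccursAt T (win T' (s a) i) b') →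
        A.card ≤ (MR T).ncard) := by
  refine card_le_of_suffix_chain T A (fun a => win T' (s a) i) ?_ ?_ hL
  · intro a ha b hb hab
    apply hinj ha hb
    have := congrArg List.length hab
    have hl : i ≤ T'.length := h.le_off.trans h.off_le_length
    dsimp only at this
    rw [length_win hl, length_win hl] at this
    have := hi a ha
    have := hi b hb
    omega
  · intro a _ b _
    rcases le_total (s a) (s b) with h | h
    · exact Or.inr (win_suffix_win h)
    · exact Or.inl (win_suffix_win h)

/-- The new right-extensions `(x, a)` of substrings `x` of `T` correspond to suffixes of the
unchanged prefix. -/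
theorem Edited.card_newRight_le (h : Edited T T' i off j) (F : Finset (List α × α))
    (hF : ∀ q ∈ F, q.1 <:+: T ∧ ¬ (q.1 ++ [q.2]) <:+: T ∧
      ∃ b, OccursAt T' (q.1 ++ [q.2]) b ∧ win T' b i ∈ LeftM T) :
    F.card ≤ (MR T).ncard + 1 := by
  classical
  have hex : ∀ q : List α × α, ∃ b, q ∈ F → OccursAt T' (q.1 ++ [q.2]) b ∧ win T' b i ∈ LeftM T :=
    fun q => by
      by_cases hq : q ∈ F
      · obtain ⟨b, hb⟩ := (hF q hq).2.2
        exact ⟨b, fun _ => hb⟩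
      · exact ⟨0, fun h => absurd h hq⟩
  choose s hs using hex
  refine (h.card_le_of_starts F s ?_ ?_ fun q hq => (hs q hq).2).1
  -- If two extensions start at the same position, the longer `x`, which occurs in `T`, would
  -- contain the shorter extension, which does not.
  · have key : ∀ q ∈ F, ∀ r ∈ F, s q = s r → q.1.length ≤ r.1.length := by
      intro q hq r hr e
      by_contra hlt
      push Not at hlt
      refine (hF r hr).2.1 (List.IsInfix.trans ?_ (hF q hq).1)
      have h1 := (hs r hr).1
      have h2 := (occursAt_append_singleton.1 (hs q hq).1).1
      rw [e] at h2
      rw [h1.eq_win, h2.eq_win]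
      exact (win_prefix_win (by simp; omega)).isInfix
    intro q hq r hr e
    have hl := le_antisymm (key q hq r hr e) (key r hr q hq e.symm)
    have h1 := (hs q hq).1
    rw [e] at h1
    have := h1.eq_of_length_eq (hs r hr).1 (by simp [hl])
    have h2 := List.append_inj this hl
    exact Prod.ext h2.1 (by simpa using h2.2)
  · intro q hq
    have := (h.straddles (hs q hq).1 (hF q hq).2.1).1
    have := h.off_le
    omega

end

/-! ### New maximal repeats -/

theorem EndsWithMarker.eq_of_getElem? {d : α} {T : List α} (h : EndsWithMarker d T) {k : ℕ}
    (hk : T[k]? = some d) : k + 1 = T.length := by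
  obtain ⟨w, hw, rfl⟩ := h
  have hl := (List.getElem?_eq_some_iff.1 hk).1
  simp only [List.length_append, List.length_singleton] at hl ⊢
  by_contra hne
  rw [List.getElem?_append_left (by omega)] at hk
  exact hw (List.mem_of_getElem? hk)

/-- The marker fixes the position of every occurrence of `x`. A left-maximal string with a single
occurrence is a prefix, and a prefix containing the end-marker is the whole text. -/
theorem marker_notMem_of_mem_MR {d : α} {T x : List α} (h : EndsWithMarker d T) (hx : x ∈ MR T) :
    d ∉ x := by
  intro hd
  obtain ⟨k, hk, hkd⟩ := List.mem_iff_getElem.1 hd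
  have key : ∀ b, OccursAt T x b → b + k + 1 = T.length := fun b hb => by
    apply h.eq_of_getElem?
    rw [(occursAt_iff.1 hb).2 k hk, ← hkd]; simp
  obtain ⟨⟨hL, -⟩, hne⟩ := hx
  obtain ⟨b, hb⟩ := infix_iff_exists_occursAt.1 hL.1
  by_cases h0 : b = 0
  · subst h0
    have := key _ hb
    have := hb.le
    exact hne ((prefix_iff_occursAt.2 hb).eq_of_length (by omega))
  · obtain ⟨c, hc⟩ := hb.leftChar_ne_none h0
    obtain ⟨b', hb', hne'⟩ := exists_leftChar_ne hL c
    have := key _ hb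
    have := key _ hb'
    obtain rfl : b = b' := by omega
    exact hne' hc

theorem exists_rightChar_of_marker_notMem {d : α} {T x : List α} (h : EndsWithMarker d T)
    (hd : d ∉ x) (hx : x ≠ []) {b : ℕ} (hb : OccursAt T x b) : ∃ a, T[b + x.length]? = some a := by
  by_contra hn
  have hnone : T[b + x.length]? = none := by
    cases hT : T[b + x.length]? with
    | none => rfl
    | some a => exact absurd ⟨a, hT⟩ hn
  have hle := hb.le
  have hpos := List.length_pos_iff.2 hx
  rw [List.getElem?_eq_none_iff] at hnone
  obtain ⟨w, _, rfl⟩ := h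
  simp only [List.length_append, List.length_singleton] at hle hnone
  have := (occursAt_iff.1 hb).2 (x.length - 1) (by omega)
  rw [show b + (x.length - 1) = w.length by omega, List.getElem?_append_right le_rfl] at this
  exact hd (List.mem_of_getElem? (i := x.length - 1) (by rw [← this]; simp))

theorem rdeg_le_one_of_notMem_RightM {T x : List α} (hx : x ∉ RightM T) : rdeg T x ≤ 1 := by
  unfold rdeg
  rw [Set.ncard_le_one (finite_rightSet T x)]
  intro a ha b hb
  by_contra hne
  exact hx ⟨(List.prefix_append x [a]).isInfix.trans ha, Or.inl ⟨a, b, hne, ha, hb⟩⟩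

theorem two_le_rdeg {d : α} {T x : List α} (h : EndsWithMarker d T) (hd : d ∉ x) (hne : x ≠ [])
    (hx : x ∈ RightM T) : 2 ≤ rdeg T x := by
  rcases hx.2 with ⟨a, b, hab, h1, h2⟩ | hs
  · unfold rdeg
    rw [Nat.succ_le_iff, Set.one_lt_ncard (finite_rightSet T x)]
    exact ⟨a, h1, b, h2, hab⟩
  · obtain ⟨b, hb, hn⟩ := suffix_iff_occursAt.1 hs
    obtain ⟨a, ha⟩ := exists_rightChar_of_marker_notMem h hd hne hb
    simp [hn] at ha

theorem mem_MR_of_mem_N {T T' x : List α} (hx : x ∈ N T T') : x ∈ MR T' := ⟨hx.1.1, hx.2⟩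

theorem ne_nil_of_mem_N {T T' x : List α} (hx : x ∈ N T T') : x ≠ [] := by
  rintro rfl
  exact hx.1.2 (nil_mem_MaxSub T)

/-! ### Additional maximal repeats -/

section

variable {d : α} {κ : EditKind} {T T' x y : List α} {i off j b : ℕ}

theorem crossPos_eq_cr (hC : ∀ b e, b < e → (Crosses κ i b e ↔ i ≤ e ∧ b ≤ off)) (hx : x ≠ []) :
    crossPos κ i T' x = cr i off T' x := by
  have := List.length_pos_iff.2 hx
  ext b
  simp only [crossPos, cr, Set.mem_ofPred_eq, ne_eq, hx, not_false_eq_true, true_and]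
  rw [hC b _ (by omega)]

/-- `x` is a new maximal repeat, neither left- nor right-maximal in `T`, all of whose
right-extensions in `T'` are those of crossing occurrences. -/
structure IsAdd (T T' : List α) (i off : ℕ) (x : List α) : Prop where
  mem_N : x ∈ N T T'
  notLeft : x ∉ LeftM T
  notRight : x ∉ RightM T
  follow : ∀ a, (x ++ [a]) <:+: T' → ∃ b ∈ cr i off T' x, T'[b + x.length]? = some a

theorem mem_N₃_iff : x ∈ N₃ T T' ↔ x ∈ N T T' ∧ x ∉ LeftM T ∧ x ∉ RightM T := by
  simp only [N₃, N₁, N₂, Set.mem_sdiff, Set.mem_union, Set.mem_inter_iff]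
  tauto

theorem mem_Nadd_iff (hC : ∀ b e, b < e → (Crosses κ i b e ↔ i ≤ e ∧ b ≤ off)) :
    x ∈ Nadd κ i T T' ↔ IsAdd T T' i off x := by
  constructor
  · rintro ⟨h3, -, hf⟩
    obtain ⟨hN, hL, hR⟩ := mem_N₃_iff.1 h3
    refine ⟨hN, hL, hR, fun a ha => ?_⟩
    obtain ⟨b, hb, ho⟩ := hf a ha
    rw [crossPos_eq_cr hC (ne_nil_of_mem_N hN)] at hb
    exact ⟨b, hb, (occursAt_append_singleton.1 ho).2⟩
  · rintro ⟨hN, hL, hR, hf⟩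
    refine ⟨mem_N₃_iff.2 ⟨hN, hL, hR⟩, fun _ => mem_MR_of_mem_N hN, fun a ha => ?_⟩
    obtain ⟨b, hb, ho⟩ := hf a ha
    rw [crossPos_eq_cr hC (ne_nil_of_mem_N hN)]
    exact ⟨b, hb, occursAt_append_singleton.2 ⟨hb.1, ho⟩⟩

theorem exists_rightChar_of_mem_N (hT' : EndsWithMarker d T') (hx : x ∈ N T T')
    (hb : OccursAt T' x b) : ∃ a, T'[b + x.length]? = some a :=
  exists_rightChar_of_marker_notMem hT' (marker_notMem_of_mem_MR hT' (mem_MR_of_mem_N hx))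
    (ne_nil_of_mem_N hx) hb

theorem two_le_rdeg_of_mem_N (hT' : EndsWithMarker d T') (hx : x ∈ N T T') : 2 ≤ rdeg T' x :=
  two_le_rdeg hT' (marker_notMem_of_mem_MR hT' (mem_MR_of_mem_N hx))
    (ne_nil_of_mem_N hx) (mem_MR_of_mem_N hx).1.2

namespace IsAdd

theorem nonempty_cr (hT' : EndsWithMarker d T') (hx : IsAdd T T' i off x) :
    (cr i off T' x).Nonempty := by
  have h2 := two_le_rdeg_of_mem_N hT' hx.mem_N
  obtain ⟨a, ha⟩ : (rightSet T' x).Nonempty :=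
    Set.nonempty_of_ncard_ne_zero (by unfold rdeg at h2; omega)
  obtain ⟨b, hb, -⟩ := hx.follow a ha
  exact ⟨b, hb⟩

theorem lo_mem (hT' : EndsWithMarker d T') (hx : IsAdd T T' i off x) :
    lo i off T' x ∈ cr i off T' x := CDAWG.lo_mem (hx.nonempty_cr hT')

theorem hi_mem (hT' : EndsWithMarker d T') (hx : IsAdd T T' i off x) :
    hi i off T' x ∈ cr i off T' x := CDAWG.hi_mem (hx.nonempty_cr hT')

theorem rightSet_subset (h : Edited T T' i off j) (hx : IsAdd T T' i off x) :
    ∀ a ∈ rightSet T' x, T'[lo i off T' x + x.length]? = some a ∨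
      T'[hi i off T' x + x.length]? = some a := by
  intro a ha
  obtain ⟨b, hb, e⟩ := hx.follow a ha
  rcases (le_hi hb).eq_or_lt with e' | hlt
  · exact Or.inr (by rw [← e', e])
  · exact Or.inl (by rw [← h.rightChar_eq_lo hb hlt, e])

theorem rdeg_le (h : Edited T T' i off j) (hT' : EndsWithMarker d T') (hx : IsAdd T T' i off x) :
    rdeg T' x ≤ 2 := by
  obtain ⟨a, ha⟩ := exists_rightChar_of_mem_N hT' hx.mem_N (hx.lo_mem hT').1
  obtain ⟨c, hc⟩ := exists_rightChar_of_mem_N hT' hx.mem_N (hx.hi_mem hT').1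
  have : rightSet T' x ⊆ {a, c} := by
    intro z hz
    rcases hx.rightSet_subset h z hz with e | e
    · rw [ha] at e; cases e; simp
    · rw [hc] at e; cases e; simp
  exact (Set.ncard_le_ncard this (by simp)).trans ((Set.ncard_insert_le a {c}).trans (by simp))

/-- A new repeat has at least two following letters, and for an additional one they all follow one
of the two extreme crossing occurrences. -/
theorem rightChar_ne (h : Edited T T' i off j) (hT' : EndsWithMarker d T')
    (hx : IsAdd T T' i off x) :
    T'[lo i off T' x + x.length]? ≠ T'[hi i off T' x + x.length]? := by
  intro he
  have h2 := two_le_rdeg_of_mem_N hT' hx.mem_N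
  unfold rdeg at h2
  rw [Nat.succ_le_iff, Set.one_lt_ncard (finite_rightSet T' x)] at h2
  obtain ⟨a, ha, c, hc, hac⟩ := h2
  have h1 : T'[lo i off T' x + x.length]? = some a := by
    rcases hx.rightSet_subset h a ha with e | e
    · exact e
    · rw [he, e]
  have h2 : T'[lo i off T' x + x.length]? = some c := by
    rcases hx.rightSet_subset h c hc with e | e
    · exact e
    · rw [he, e]
  exact hac (Option.some.inj (h1.symm.trans h2))

theorem lo_lt_hi (h : Edited T T' i off j) (hT' : EndsWithMarker d T')
    (hx : IsAdd T T' i off x) : lo i off T' x < hi i off T' x := by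
  refine lt_of_le_of_ne (lo_le (hx.hi_mem hT')) fun e => hx.rightChar_ne h hT' ?_
  rw [e]

end IsAdd

/-- The additional maximal repeats that occur in `T`, and whose leftmost crossing occurrence
extends to the left and whose rightmost one extends to the right, inside `T`. -/
structure IsKept (T T' : List α) (i off : ℕ) (x : List α) : Prop where
  isAdd : IsAdd T T' i off x
  occurs : x <:+: T
  pos : 1 ≤ lo i off T' x
  left : win T' (lo i off T' x - 1) (lo i off T' x + x.length) <:+: T
  right : win T' (hi i off T' x) (hi i off T' x + x.length + 1) <:+: T

theorem win_succ_eq {a : α} (hx : OccursAt T' x b) (ha : T'[b + x.length]? = some a) :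
    win T' b (b + x.length + 1) = x ++ [a] := by
  have := (occursAt_append_singleton.2 ⟨hx, ha⟩).eq_win
  rw [this]; congr 1; simp; omega

theorem win_pred_eq {a : α} (hb : 1 ≤ b) (hx : OccursAt T' x b) (ha : leftChar T' b = some a) :
    win T' (b - 1) (b + x.length) = a :: x := by
  have h1 : OccursAt T' (a :: x) (b - 1) := by
    rw [occursAt_cons]
    rw [leftChar_of_pos hb] at ha
    exact ⟨by rwa [Nat.sub_add_cancel hb], ha⟩
  rw [h1.eq_win]; congr 1; simp; omega

/-- An additional maximal repeat of `T` that is not kept has a new right-extension, which begins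
with a left-maximal suffix of the unchanged prefix. -/
theorem IsAdd.exists_newRight (h : Edited T T' i off j) (hT' : EndsWithMarker d T')
    (hx : IsAdd T T' i off x) (hxT : x <:+: T) (hK : ¬ IsKept T T' i off x) :
    ∃ a, ¬ (x ++ [a]) <:+: T ∧ ∃ b, OccursAt T' (x ++ [a]) b ∧ win T' b i ∈ LeftM T := by
  obtain ⟨c, hc⟩ := exists_leftChar_of_notMem_LeftM hxT hx.notLeft
  obtain ⟨a₀, ha₀⟩ := exists_rightChar_of_notMem_RightM hxT hx.notRight
  have hLm := hx.lo_mem hT'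
  have hRm := hx.hi_mem hT'
  obtain ⟨aL, haL⟩ := exists_rightChar_of_mem_N hT' hx.mem_N hLm.1
  obtain ⟨aR, haR⟩ := exists_rightChar_of_mem_N hT' hx.mem_N hRm.1
  have hne := hx.rightChar_ne h hT'
  have hlt := hx.lo_lt_hi h hT'
  obtain ⟨-, hnew⟩ := h.newLeft_lo_or_hi hc (mem_MR_of_mem_N hx.mem_N).1.1
  have hlen : i ≤ T'.length := h.le_off.trans h.off_le_length
  set L := lo i off T' x
  set R := hi i off T' x
  have hpre : ∀ b ∈ cr i off T' x, win T' b i <+: x := fun b hb => by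
    conv_rhs => rw [hb.1.eq_win]
    exact win_prefix_win hb.2.1
  obtain ⟨q, hq⟩ := infix_iff_exists_occursAt.1 hxT
  have hown : ∀ b ≤ i, OccursAt T (win T' b i) b := fun b hb =>
    h.occ_left (occursAt_win hb hlen) (by rw [length_win hlen]; omega)
  -- In `T` the repeat is followed only by `a₀`, so at most one of the distinct letters `aL`, `aR`
  -- is old. If `aR` is old, the leftmost occurrence cannot be preceded by `c`, since `x` would then
  -- be kept.
  by_cases hR : (x ++ [aR]) <:+: T
  · have hLn : ¬ (x ++ [aL]) <:+: T := fun hL => hne <| by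
      obtain ⟨b, hb, e⟩ := append_singleton_infix_iff.1 hL
      obtain ⟨b', hb', e'⟩ := append_singleton_infix_iff.1 hR
      rw [haL, haR, ← e, ← e', ha₀ b hb, ha₀ b' hb']
    refine ⟨aL, hLn, L, occursAt_append_singleton.2 ⟨hLm.1, haL⟩, ?_⟩
    have hLi : L ≤ i := by have := h.off_le; have := hRm.2; omega
    refine mem_LeftM_of_leftChar_ne (hown L hLi) (hq.of_prefix (hpre L hLm)) ?_
    rw [h.leftChar_left hLi, hc q hq]
    intro hl
    have hpos : 1 ≤ L := by
      by_contra h0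
      rw [show L = 0 by omega] at hl
      simp [leftChar] at hl
    refine hK ⟨hx, hxT, hpos, ?_, ?_⟩
    · rw [win_pred_eq hpos hLm.1 hl]
      exact cons_infix_iff.2 ⟨q, hq, hc q hq⟩
    · rwa [win_succ_eq hRm.1 haR]
  · have ho := occursAt_append_singleton.2 ⟨hRm.1, haR⟩
    refine ⟨aR, hR, R, ho, ?_⟩
    have hRi : R ≤ i := by have := (h.straddles ho hR).1; have := h.off_le; omega
    have hoL : OccursAt T (win T' R i) L :=
      h.occ_left (hLm.1.of_prefix (hpre R hRm)) (by rw [length_win hlen]; omega)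
    -- If the left letters agree, neither is `c`, and the window at `R` is compared with an
    -- occurrence of `x` in `T`; otherwise it is compared with its own copy at `L`.
    by_cases hl : leftChar T' L = leftChar T' R
    · refine mem_LeftM_of_leftChar_ne (hown R hRi) (hq.of_prefix (hpre R hRm)) ?_
      rw [h.leftChar_left hRi, hc q hq]
      rw [hl, or_self] at hnew
      exact hnew
    · refine mem_LeftM_of_leftChar_ne hoL (hown R hRi) ?_
      rwa [h.leftChar_left hRi, h.leftChar_left (by omega)]

theorem Edited.sum_newRight_le (h : Edited T T' i off j) (S : Finset (List α))
    (g : List α → Finset α) (hS : ∀ x ∈ S, x <:+: T) (hg : ∀ x ∈ S, ∀ a ∈ g x,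
      ¬ (x ++ [a]) <:+: T ∧ ∃ b, OccursAt T' (x ++ [a]) b ∧ win T' b i ∈ LeftM T) :
    ∑ x ∈ S, (g x).card ≤ (MR T).ncard + 1 := by
  have := h.card_newRight_le ((S.sigma g).map (Equiv.sigmaEquivProd (List α) α).toEmbedding) ?_
  · rwa [Finset.card_map, Finset.card_sigma] at this
  · intro q hq
    rw [Finset.mem_map] at hq
    obtain ⟨⟨z, a⟩, hz, rfl⟩ := hq
    rw [Finset.mem_sigma] at hz
    exact ⟨hS z hz.1, hg z hz.1 a hz.2⟩

/-- A new right-extension of a left-maximal substring of `T`. -/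
theorem Edited.exists_newRight_of_mem_LeftM (h : Edited T T' i off j) (hx : x ∈ LeftM T) {a : α}
    (ha : (x ++ [a]) <:+: T') (hn : ¬ (x ++ [a]) <:+: T) :
    ∃ b, OccursAt T' (x ++ [a]) b ∧ win T' b i ∈ LeftM T := by
  obtain ⟨b, hb⟩ := infix_iff_exists_occursAt.1 ha
  refine ⟨b, hb, mem_LeftM_of_prefix hx ?_⟩
  have h1 := (h.straddles hb hn).2
  rw [(occursAt_append_singleton.1 hb).1.eq_win]
  simp only [List.length_append, List.length_singleton] at h1
  exact win_prefix_win (by omega)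

/-- The out-degrees of the nodes that are left-maximal in `T`. -/
theorem Edited.sum_rdeg_le (h : Edited T T' i off j) (hT' : EndsWithMarker d T')
    (S A Q : Finset (List α)) (hS : ∀ x ∈ S, x ∈ MaxSub T) (hA : ∀ x ∈ A, x ∈ N₂ T T')
    (hQ : ∀ x ∈ Q, IsAdd T T' i off x ∧ x <:+: T ∧ ¬ IsKept T T' i off x) :
    ∑ x ∈ S, rdeg T' x + ∑ x ∈ A, rdeg T' x + Q.card ≤
      size T + A.card + (MR T).ncard + 1 := by
  classical
  have hex : ∀ x, ∃ a, x ∈ Q → ¬ (x ++ [a]) <:+: T ∧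
      ∃ b, OccursAt T' (x ++ [a]) b ∧ win T' b i ∈ LeftM T := fun x => by
    by_cases hx : x ∈ Q
    · obtain ⟨a, ha⟩ := (hQ x hx).1.exists_newRight h hT' (hQ x hx).2.1 (hQ x hx).2.2
      exact ⟨a, fun _ => ha⟩
    · exact ⟨d, fun h => absurd h hx⟩
  choose p hp using hex
  let new : List α → Finset α := fun x =>
    ((finite_rightSet T' x).subset (Set.sdiff_subset (t := rightSet T x))).toFinset
  have hnew : ∀ x a, a ∈ new x ↔ (x ++ [a]) <:+: T' ∧ ¬ (x ++ [a]) <:+: T := fun x a => by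
    simp [new, rightSet]
  have hrd : ∀ x, rdeg T' x ≤ rdeg T x + (new x).card := fun x => by
    rw [← Set.ncard_coe_finset]
    refine (Set.ncard_le_ncard ?_ ((finite_rightSet T x).union (new x).finite_toSet)).trans
      (Set.ncard_union_le _ _)
    intro a ha
    by_cases hT : a ∈ rightSet T x
    · exact Or.inl hT
    · exact Or.inr ((hnew x a).2 ⟨ha, hT⟩)
  -- Every string of `S ∪ A` contributes all its new letters, and a repeat of `Q` the one new letter
  -- chosen for it. All these extensions are counted together, which costs `m + 1` once.
  let g : List α → Finset α := fun x => if x ∈ Q then {p x} else new x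
  have hSL : ∀ x ∈ S ∪ A, x ∈ LeftM T := fun x hx => by
    rcases Finset.mem_union.1 hx with hx | hx
    · exact (hS x hx).1
    · exact (hA x hx).2
  have hSAQ : Disjoint (S ∪ A) Q := Finset.disjoint_left.2 fun x hx hx' =>
    (hQ x hx').1.notLeft (hSL x hx)
  have hSA : Disjoint S A := Finset.disjoint_left.2 fun x hx hx' => (hA x hx').1.1.2 (hS x hx)
  have key := h.sum_newRight_le ((S ∪ A) ∪ Q) g ?_ ?_
  · rw [Finset.sum_union hSAQ, Finset.sum_union hSA] at key
    have e0 : ∑ x ∈ Q, (g x).card = Q.card := by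
      rw [Finset.card_eq_sum_ones]
      exact Finset.sum_congr rfl fun x hx => by simp [g, hx]
    have e1 : ∑ x ∈ S, rdeg T' x ≤ size T + ∑ x ∈ S, (g x).card := by
      have hs : ∑ x ∈ S, rdeg T x ≤ size T := by
        rw [size_eq_sum]
        exact Finset.sum_le_sum_of_subset fun x hx => by simpa using hS x hx
      refine le_trans ?_ (Nat.add_le_add_right hs _)
      rw [← Finset.sum_add_distrib]
      refine Finset.sum_le_sum fun x hx => ?_
      have : x ∉ Q := Finset.disjoint_left.1 hSAQ (Finset.mem_union_left _ hx)
      simpa [g, this] using hrd x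
    have e2 : ∑ x ∈ A, rdeg T' x ≤ A.card + ∑ x ∈ A, (g x).card := by
      rw [Finset.card_eq_sum_ones, ← Finset.sum_add_distrib]
      refine Finset.sum_le_sum fun x hx => ?_
      have : x ∉ Q := Finset.disjoint_left.1 hSAQ (Finset.mem_union_right _ hx)
      -- A member of `N₂` is left- but not right-maximal in `T`, so it brings at most one old
      -- letter; this is the summand `|A|`.
      have h1 : rdeg T x ≤ 1 := rdeg_le_one_of_notMem_RightM fun hR =>
        (hA x hx).1.1.2 ⟨(hA x hx).2, hR⟩
      have := hrd x
      simp only [g, ‹x ∉ Q›, if_false]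
      omega
    omega
  · intro x hx
    rcases Finset.mem_union.1 hx with hx | hx
    · exact (hSL x hx).1
    · exact (hQ x hx).2.1
  · intro x hx a ha
    by_cases hxQ : x ∈ Q
    · simp only [g, hxQ, if_true, Finset.mem_singleton] at ha
      subst ha
      exact hp x hxQ
    · simp only [g, hxQ, if_false] at ha
      rw [hnew] at ha
      have hx' : x ∈ S ∪ A := (Finset.mem_union.1 hx).resolve_right hxQ
      exact ⟨ha.2, h.exists_newRight_of_mem_LeftM (hSL x hx') ha.1 ha.2⟩

end

/-! ### Basic maximal repeats -/

section

variable {d : α} {κ : EditKind} {T T' x y : List α} {i off j b : ℕ}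

/-- `x` is a new maximal repeat that occurs in `T` but is not left-maximal there, and it is
right-maximal in `T` or has a right-extension in `T` that no crossing occurrence has. -/
structure IsBase (T T' : List α) (i off : ℕ) (x : List α) : Prop where
  mem_N : x ∈ N T T'
  notLeft : x ∉ LeftM T
  occurs : x <:+: T
  right : x ∈ RightM T ∨
    ∃ a, (x ++ [a]) <:+: T ∧ ∀ b ∈ cr i off T' x, T'[b + x.length]? ≠ some a

theorem Edited.infix_of_not_crossing (h : Edited T T' i off j) {a : α}
    (ha : (x ++ [a]) <:+: T') (hn : ∀ b ∈ cr i off T' x, T'[b + x.length]? ≠ some a) :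
    (x ++ [a]) <:+: T := by
  by_contra hT
  obtain ⟨b, hb⟩ := infix_iff_exists_occursAt.1 ha
  obtain ⟨h1, h2⟩ := h.straddles hb hT
  obtain ⟨h3, h4⟩ := occursAt_append_singleton.1 hb
  simp only [List.length_append, List.length_singleton] at h2
  exact hn b ⟨h3, by omega, by omega⟩ h4

theorem isBase_of_mem (h : Edited T T' i off j)
    (hC : ∀ b e, b < e → (Crosses κ i b e ↔ i ≤ e ∧ b ≤ off))
    (hx : x ∈ N₁ T T' ∪ Nbase κ i T T') : IsBase T T' i off x := by
  rcases hx with ⟨hN, hR⟩ | ⟨h3, hadd⟩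
  · exact ⟨hN, fun hL => hN.1.2 ⟨hL, hR⟩, hR.1, Or.inl hR⟩
  · obtain ⟨hN, hL, hR⟩ := mem_N₃_iff.1 h3
    rw [mem_Nadd_iff hC] at hadd
    have : ∃ a, (x ++ [a]) <:+: T' ∧ ∀ b ∈ cr i off T' x, T'[b + x.length]? ≠ some a := by
      by_contra hne
      push Not at hne
      exact hadd ⟨hN, hL, hR, hne⟩
    obtain ⟨a, ha, hn⟩ := this
    have haT := h.infix_of_not_crossing ha hn
    exact ⟨hN, hL, (List.prefix_append x [a]).isInfix.trans haT, Or.inr ⟨a, haT, hn⟩⟩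

/-- No longer substring of `T` has an occurrence in `T'` that ends with the occurrence of `x`
at `b`. -/
def EndUnshared (T T' x : List α) (b : ℕ) : Prop :=
  ∀ y b', y <:+: T → OccursAt T' y b' → b + x.length = b' + y.length → y.length ≤ x.length

theorem endUnshared_of_leftChar_ne {c : α} (hc : ∀ b, OccursAt T x b → leftChar T b = some c)
    (hb : OccursAt T' x b) (hne : leftChar T' b ≠ some c) : EndUnshared T T' x b := by
  intro y b' hy hyb he
  by_contra hlt
  exact hne (leftChar_of_shared_end hc hb hyb hy he (by omega))

/-- The window is a suffix of `x`, hence followed by `a` somewhere in `T`; at its own position, in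
the unchanged suffix, it is followed by `a'`. -/
theorem mem_RightM_of_followed (h : Edited T T' i off j) {a a' : α} (hb : OccursAt T' x b)
    (hbo : b ≤ off) (he : off ≤ b + x.length) (ha : (x ++ [a]) <:+: T)
    (ha' : T'[b + x.length]? = some a') (hne : a ≠ a') :
    win T' off (b + x.length) ∈ RightM T := by
  have hsuf : win T' off (b + x.length) <:+ x := by
    conv_rhs => rw [hb.eq_win]
    exact win_suffix_win hbo
  have h1 : a ∈ rightSet T (win T' off (b + x.length)) := rightSet_subset_of_suffix hsuf ha
  have h2 : OccursAt T' (win T' off (b + x.length) ++ [a']) off := by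
    rw [occursAt_append_singleton, length_win hb.le]
    exact ⟨occursAt_win he hb.le, by rw [← ha']; congr 1; omega⟩
  exact ⟨(List.prefix_append _ [a]).isInfix.trans h1,
    Or.inl ⟨a, a', hne, h1, (h.occ_right h2 le_rfl).isInfix⟩⟩

theorem IsBase.mem_RightM (h : Edited T T' i off j) (hT' : EndsWithMarker d T')
    (hx : IsBase T T' i off x) (hb : b ∈ cr i off T' x) (he : off ≤ b + x.length) :
    win T' off (b + x.length) ∈ RightM T := by
  rcases hx.right with hR | ⟨a, ha, hn⟩
  · refine mem_RightM_of_suffix hR ?_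
    conv_rhs => rw [hb.1.eq_win]
    exact win_suffix_win hb.2.2
  · obtain ⟨a', ha'⟩ := exists_rightChar_of_mem_N hT' hx.mem_N hb.1
    exact mem_RightM_of_followed h hb.1 hb.2.2 he ha ha' fun e => hn b hb (by rw [ha', e])

theorem IsBase.exists_newEnd (h : Edited T T' i off j) (hT' : EndsWithMarker d T')
    (hx : IsBase T T' i off x) : ∃ b, (b = lo i off T' x ∨ b = hi i off T' x) ∧
      b ∈ cr i off T' x ∧ off ≤ b + x.length ∧ EndUnshared T T' x b ∧
      win T' off (b + x.length) ∈ RightM T := by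
  obtain ⟨c, hc⟩ := exists_leftChar_of_notMem_LeftM hx.occurs hx.notLeft
  obtain ⟨hne, hnew⟩ := h.newLeft_lo_or_hi hc hx.mem_N.1.1.1
  have key : ∀ b ∈ cr i off T' x, leftChar T' b ≠ some c → b ∈ cr i off T' x ∧
      off ≤ b + x.length ∧ EndUnshared T T' x b ∧ win T' off (b + x.length) ∈ RightM T := by
    intro b hb hn
    have := h.lt_of_newLeft hc hb (ne_nil_of_mem_N hx.mem_N) hn
    have hoff : off ≤ b + x.length := by have := h.off_le; omega
    exact ⟨hb, hoff, endUnshared_of_leftChar_ne hc hb.1 hn, hx.mem_RightM h hT' hb hoff⟩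
  rcases hnew with hn | hn
  · exact ⟨_, Or.inl rfl, key _ (lo_mem hne) hn⟩
  · exact ⟨_, Or.inr rfl, key _ (hi_mem hne) hn⟩

theorem IsAdd.exists_newEnd (h : Edited T T' i off j) (hT' : EndsWithMarker d T')
    (hx : IsAdd T T' i off x) (hxT : x <:+: T) (hK : ¬ IsKept T T' i off x) :
    ∃ b, b ∈ cr i off T' x ∧ off ≤ b + x.length ∧ EndUnshared T T' x b ∧
      win T' off (b + x.length) ∈ RightM T := by
  obtain ⟨c, hc⟩ := exists_leftChar_of_notMem_LeftM hxT hx.notLeft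
  obtain ⟨a₀, ha₀⟩ := exists_rightChar_of_notMem_RightM hxT hx.notRight
  have hLm := hx.lo_mem hT'
  have hRm := hx.hi_mem hT'
  obtain ⟨aL, haL⟩ := exists_rightChar_of_mem_N hT' hx.mem_N hLm.1
  obtain ⟨aR, haR⟩ := exists_rightChar_of_mem_N hT' hx.mem_N hRm.1
  have hne := hx.rightChar_ne h hT'
  have hlt := hx.lo_lt_hi h hT'
  obtain ⟨-, hnew⟩ := h.newLeft_lo_or_hi hc (mem_MR_of_mem_N hx.mem_N).1.1
  obtain ⟨q, hq⟩ := infix_iff_exists_occursAt.1 hxT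
  have hnil := ne_nil_of_mem_N hx.mem_N
  -- If the leftmost occurrence has the old left letter, the rightmost has a new one, and its right
  -- letter must be new too, since `x` is not kept. Otherwise the leftmost end works: its window
  -- reappears as a suffix of the rightmost occurrence, followed there by a different letter.
  by_cases hl : leftChar T' (lo i off T' x) = some c
  · have hn := hnew.resolve_left (fun hn => hn hl)
    have := h.lt_of_newLeft hc hRm hnil hn
    have hoff : off ≤ hi i off T' x + x.length := by have := h.off_le; omega
    refine ⟨_, hRm, hoff, endUnshared_of_leftChar_ne hc hRm.1 hn, ?_⟩
    have ha₀T : (x ++ [a₀]) <:+: T := append_singleton_infix_iff.2 ⟨q, hq, ha₀ q hq⟩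
    refine mem_RightM_of_followed h hRm.1 hRm.2.2 hoff ha₀T haR fun e => hK ?_
    have hpos : 1 ≤ lo i off T' x := by
      by_contra h0
      rw [show lo i off T' x = 0 by omega] at hl
      simp [leftChar] at hl
    refine ⟨hx, hxT, hpos, ?_, ?_⟩
    · rw [win_pred_eq hpos hLm.1 hl]
      exact cons_infix_iff.2 ⟨q, hq, hc q hq⟩
    · rwa [win_succ_eq hRm.1 haR, ← e]
  · have := h.lt_of_newLeft hc hLm hnil hl
    have hoff : off ≤ lo i off T' x + x.length := by have := h.off_le; omega
    refine ⟨_, hLm, hoff, endUnshared_of_leftChar_ne hc hLm.1 hl, ?_⟩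
    have hsuf : win T' off (lo i off T' x + x.length) <:+ x := by
      conv_rhs => rw [hLm.1.eq_win]
      exact win_suffix_win hLm.2.2
    have hlen := length_win (b := off) hLm.1.le
    have h1 := occursAt_win hoff hLm.1.le
    have h2 := hRm.1.of_suffix hsuf
    rw [hlen] at h2
    have := hLm.2
    refine mem_RightM_of_ne (h.occ_right h1 le_rfl) (h.occ_right h2 (by omega)) ?_
    rw [h.rightChar_right le_rfl, h.rightChar_right (by omega), hlen]
    rwa [show off + (lo i off T' x + x.length - off) = lo i off T' x + x.length by omega,
      show hi i off T' x + (x.length - (lo i off T' x + x.length - off)) +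
        (lo i off T' x + x.length - off) = hi i off T' x + x.length by omega]

theorem eq_of_endUnshared {b' : ℕ} (hxT : x <:+: T) (hyT : y <:+: T) (hx : OccursAt T' x b)
    (hy : OccursAt T' y b') (hux : EndUnshared T T' x b) (huy : EndUnshared T T' y b')
    (he : b + x.length = b' + y.length) : x = y := by
  have h1 := hux y b' hyT hy he
  have h2 := huy x b hxT hx he.symm
  obtain rfl : b = b' := by omega
  exact hx.eq_of_length_eq hy (by omega)

/-- Basic repeats and additional repeats that are not kept are few. -/
theorem Edited.card_add_card_le (h : Edited T T' i off j) (hT' : EndsWithMarker d T')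
    (B Q : Finset (List α)) (hB : ∀ x ∈ B, IsBase T T' i off x) (hBQ : Disjoint B Q)
    (hQ : ∀ x ∈ Q, IsAdd T T' i off x ∧ x <:+: T ∧ ¬ IsKept T T' i off x) :
    B.card + Q.card ≤ (MR T).ncard := by
  classical
  have hex : ∀ x, ∃ b, x ∈ B ∪ Q → x ∈ N T T' ∧ x <:+: T ∧ b ∈ cr i off T' x ∧
      off ≤ b + x.length ∧ EndUnshared T T' x b ∧ win T' off (b + x.length) ∈ RightM T := by
    intro x
    by_cases hx : x ∈ B ∪ Q
    · rcases Finset.mem_union.1 hx with hx' | hx'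
      · obtain ⟨b, -, hb⟩ := (hB x hx').exists_newEnd h hT'
        exact ⟨b, fun _ => ⟨(hB x hx').mem_N, (hB x hx').occurs, hb⟩⟩
      · obtain ⟨b, hb⟩ := (hQ x hx').1.exists_newEnd h hT' (hQ x hx').2.1 (hQ x hx').2.2
        exact ⟨b, fun _ => ⟨(hQ x hx').1.mem_N, (hQ x hx').2.1, hb⟩⟩
    · exact ⟨0, fun h => absurd h hx⟩
  choose s hs using hex
  rw [← Finset.card_union_of_disjoint hBQ]
  refine (h.card_and_sum_le_of_ends (B ∪ Q) (fun x => s x + x.length) ?_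
    (fun x hx => (hs x hx).2.2.2.1) (fun x hx => (hs x hx).2.2.2.2.2)
    fun x hx => exists_rightChar_of_mem_N hT' (hs x hx).1 (hs x hx).2.2.1.1).1
  intro x hx y hy he
  exact eq_of_endUnshared (hs x hx).2.1 (hs y hy).2.1 (hs x hx).2.2.1.1 (hs y hy).2.2.1.1
    (hs x hx).2.2.2.2.1 (hs y hy).2.2.2.2.1 he

/-- A letter that follows no crossing occurrence is old, and by periodicity the crossing ones
contribute at most two letters. -/
theorem Edited.rdeg_le_add_two (h : Edited T T' i off j) (hT' : EndsWithMarker d T')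
    (hx : x ∈ N T T') (hne : (cr i off T' x).Nonempty) : rdeg T' x ≤ rdeg T x + 2 := by
  obtain ⟨aL, haL⟩ := exists_rightChar_of_mem_N hT' hx (lo_mem hne).1
  obtain ⟨aR, haR⟩ := exists_rightChar_of_mem_N hT' hx (hi_mem hne).1
  have hsub : rightSet T' x ⊆ rightSet T x ∪ {aL, aR} := by
    intro a ha
    by_cases hn : ∀ b ∈ cr i off T' x, T'[b + x.length]? ≠ some a
    · exact Or.inl (h.infix_of_not_crossing ha hn)
    · push Not at hn
      obtain ⟨b, hb, e⟩ := hn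
      rcases (le_hi hb).eq_or_lt with e' | hlt
      · rw [e', haR] at e; cases e; simp
      · rw [h.rightChar_eq_lo hb hlt, haL] at e; cases e; simp
  refine (Set.ncard_le_ncard hsub ((finite_rightSet T x).union (by simp))).trans ?_
  refine (Set.ncard_union_le _ _).trans (Nat.add_le_add_left ?_ _)
  exact (Set.ncard_insert_le aL {aR}).trans (by simp)

/-! ### Associated strings and weights -/

theorem IsLeftRep.unique {s u v : List α} (hu : IsLeftRep T s u) (hv : IsLeftRep T s v) :
    u = v := by
  obtain ⟨w, hw, hsw⟩ := exists_leftExt (hu.2.1.isInfix.trans hu.1.1)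
  rw [← hsw.eq_of_isLeftRep hw hu, ← hsw.eq_of_isLeftRep hw hv]

theorem sLeft_eq_win (hC : ∀ b e, b < e → (Crosses κ i b e ↔ i ≤ e ∧ b ≤ off)) (hx : x ≠ []) :
    sLeft κ i T' x = win T' i (lo i off T' x + x.length) := by
  unfold sLeft; rw [crossPos_eq_cr hC hx]; rfl

theorem sRight_eq_win (hC : ∀ b e, b < e → (Crosses κ i b e ↔ i ≤ e ∧ b ≤ off)) (hx : x ≠ []) :
    sRight κ i T' x = win T' i (hi i off T' x + x.length) := by
  unfold sRight; rw [crossPos_eq_cr hC hx]; rfl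

theorem win_inj_right {e e' : ℕ} (h : win T' i e = win T' i e') (hi : i ≤ e) (hi' : i ≤ e')
    (he : e ≤ T'.length) (he' : e' ≤ T'.length) : e = e' := by
  have := congrArg List.length h
  rw [length_win he, length_win he'] at this
  omega

theorem IsBase.nonempty_cr (h : Edited T T' i off j) (hT' : EndsWithMarker d T')
    (hx : IsBase T T' i off x) : (cr i off T' x).Nonempty := by
  obtain ⟨b, -, hb, -⟩ := hx.exists_newEnd h hT'
  exact ⟨b, hb⟩

/-- The occurrence that is associated with a basic repeat. -/
theorem exists_assoc (h : Edited T T' i off j) (hT' : EndsWithMarker d T')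
    (hC : ∀ b e, b < e → (Crosses κ i b e ↔ i ≤ e ∧ b ≤ off))
    (hx : x ∈ N₁ T T' ∪ Nbase κ i T T') :
    ∃ b, (b = lo i off T' x ∨ b = hi i off T' x) ∧ b ∈ cr i off T' x ∧
      assocS κ i T T' x = win T' i (b + x.length) ∧
      ∀ y ∈ N₁ T T' ∪ Nbase κ i T T', ∀ b', (b' = lo i off T' y ∨ b' = hi i off T' y) →
        b + x.length = b' + y.length → y.length ≤ x.length := by
  have hxB := isBase_of_mem h hC hx
  have hxn := ne_nil_of_mem_N hxB.mem_N
  have hxc := hxB.nonempty_cr h hT'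
  unfold assocS
  split_ifs with hs
  · refine ⟨_, Or.inr rfl, hi_mem hxc, sRight_eq_win hC hxn, fun y hy b' hb' he => ?_⟩
    by_contra hlt
    obtain ⟨c, hc⟩ := exists_leftChar_of_notMem_LeftM hxB.occurs hxB.notLeft
    obtain ⟨-, hnew⟩ := h.newLeft_lo_or_hi hc hxB.mem_N.1.1.1
    have hyB := isBase_of_mem h hC hy
    have hyc := hyB.nonempty_cr h hT'
    have hb'm : b' ∈ cr i off T' y := by
      rcases hb' with rfl | rfl
      exacts [lo_mem hyc, hi_mem hyc]
    have hR := leftChar_of_shared_end hc (hi_mem hxc).1 hb'm.1 hyB.occurs he (by omega)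
    refine hnew.elim ?_ (fun hn => hn hR)
    -- If the end of the rightmost occurrence were shared with a longer repeat as well as that of
    -- the leftmost, both would be preceded by `c`, and `x` would not be left-maximal in `T'`.
    refine fun hn => hn ?_
    obtain ⟨z, hz, hzl, hzs⟩ := hs
    have hzB := isBase_of_mem h hC hz
    have hzc := hzB.nonempty_cr h hT'
    have hzn := ne_nil_of_mem_N hzB.mem_N
    rw [sLeft_eq_win hC hxn, sLeft_eq_win hC hzn, sRight_eq_win hC hzn] at hzs
    rcases hzs with e | e
    · exact leftChar_of_shared_end hc (lo_mem hxc).1 (lo_mem hzc).1 hzB.occurs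
        (win_inj_right e (lo_mem hxc).2.1 (lo_mem hzc).2.1 (lo_mem hxc).1.le (lo_mem hzc).1.le) hzl
    · exact leftChar_of_shared_end hc (lo_mem hxc).1 (hi_mem hzc).1 hzB.occurs
        (win_inj_right e (lo_mem hxc).2.1 (hi_mem hzc).2.1 (lo_mem hxc).1.le (hi_mem hzc).1.le) hzl
  · refine ⟨_, Or.inl rfl, lo_mem hxc, sLeft_eq_win hC hxn, fun y hy b' hb' he => ?_⟩
    by_contra hlt
    have hyn := ne_nil_of_mem_N (isBase_of_mem h hC hy).mem_N
    refine hs ⟨y, hy, by omega, ?_⟩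
    rw [sLeft_eq_win hC hxn, sLeft_eq_win hC hyn, sRight_eq_win hC hyn, he]
    rcases hb' with rfl | rfl
    exacts [Or.inl rfl, Or.inr rfl]

open Classical in
/-- The out-degree of a basic repeat, with the gain that it allows. -/
noncomputable def weight (κ : EditKind) (i : ℕ) (T T' x : List α) : ℕ :=
  rdeg T' x + ((if x ∈ Nmid κ i T T' then 1 else 0) + 2 * if x ∈ Nless κ i T T' then 1 else 0)

/-- The gains are built for this bound: 1 when the degree is exactly one above that of `U(x)`, 2
when it is not above it. The degree of `U(x)` is at most that of any suffix `s` of the associated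
string. -/
theorem weight_le (hx : x ∈ MaxSub T') {s : List α} (hs : s <:+ assocS κ i T T' x)
    (hd : rdeg T' x ≤ rdeg T s + 2) : weight κ i T T' x ≤ rdeg T s + 2 := by
  have hdeg : ∀ u, IsU κ i T T' x u → outDeg T u ≤ rdeg T s := fun u hu =>
    (outDeg_le_rdeg T u).trans (rdeg_le_of_suffix (hs.trans hu.2.1))
  have he := outDeg_eq_rdeg hx
  unfold weight
  split_ifs with h1 h2 h2
  · obtain ⟨-, u, hu, e⟩ := h1
    obtain ⟨-, v, hv, e'⟩ := h2
    rw [IsLeftRep.unique hu hv] at e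
    omega
  · obtain ⟨-, u, hu, e⟩ := h1
    have := hdeg u hu
    omega
  · obtain ⟨-, u, hu, e⟩ := h2
    have := hdeg u hu
    omega
  · omega

theorem weight_le_rdeg_add_two (hx : x ∈ MaxSub T') : weight κ i T T' x ≤ rdeg T' x + 2 := by
  unfold weight
  have he := outDeg_eq_rdeg hx
  split_ifs with h1 h2 h2
  · obtain ⟨-, u, hu, e⟩ := h1
    obtain ⟨-, v, hv, e'⟩ := h2
    rw [IsLeftRep.unique hu hv] at e
    omega
  all_goals omega

theorem Edited.sum_weight_le (h : Edited T T' i off j) (hT' : EndsWithMarker d T')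
    (hC : ∀ b e, b < e → (Crosses κ i b e ↔ i ≤ e ∧ b ≤ off)) (B : Finset (List α))
    (hB : ∀ x ∈ B, x ∈ N₁ T T' ∪ Nbase κ i T T') :
    ∑ x ∈ B, weight κ i T T' x ≤ size T + 2 * B.card + 2 := by
  classical
  have hbase : ∀ x ∈ B, IsBase T T' i off x := fun x hx => isBase_of_mem h hC (hB x hx)
  have hex : ∀ x, ∃ b, x ∈ B → (b = lo i off T' x ∨ b = hi i off T' x) ∧ b ∈ cr i off T' x ∧
      assocS κ i T T' x = win T' i (b + x.length) ∧
      ∀ y ∈ B, ∀ b', (b' = lo i off T' y ∨ b' = hi i off T' y) →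
        b + x.length = b' + y.length → y.length ≤ x.length := fun x => by
    by_cases hx : x ∈ B
    · obtain ⟨b, h1, h2, h3, h4⟩ := exists_assoc h hT' hC (hB x hx)
      exact ⟨b, fun _ => ⟨h1, h2, h3, fun y hy => h4 y (hB y hy)⟩⟩
    · exact ⟨0, fun h => absurd h hx⟩
  choose s hs using hex
  have hex' : ∀ x, ∃ b, x ∈ B → (b = lo i off T' x ∨ b = hi i off T' x) ∧ b ∈ cr i off T' x ∧
      off ≤ b + x.length ∧ EndUnshared T T' x b := fun x => by
    by_cases hx : x ∈ B
    · obtain ⟨b, h1, h2, h3, h4, -⟩ := (hbase x hx).exists_newEnd h hT'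
      exact ⟨b, fun _ => ⟨h1, h2, h3, h4⟩⟩
    · exact ⟨0, fun h => absurd h hx⟩
  choose t ht using hex'
  have huniq : ∀ f : List α → ℕ, (∀ x ∈ B, (f x = lo i off T' x ∨ f x = hi i off T' x) ∧
      f x ∈ cr i off T' x ∧ ∀ y ∈ B, ∀ b', (b' = lo i off T' y ∨ b' = hi i off T' y) →
        f x + x.length = b' + y.length → y.length ≤ x.length) →
      ∀ x ∈ B, ∀ y ∈ B, f x + x.length = f y + y.length → x = y := by
    intro f hf x hx y hy he
    have h1 := (hf x hx).2.2 y hy _ (hf y hy).1 he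
    have h2 := (hf y hy).2.2 x hx _ (hf x hx).1 he.symm
    have h3 := (hf x hx).2.1.1
    rw [show f x = f y by omega] at h3
    exact h3.eq_of_length_eq (hf y hy).2.1.1 (by omega)
  -- An associated end before `off` can only be `i`, with `off = i + 1`. Associated ends are
  -- distinct, so this happens at most once.
  let E := B.filter fun x => s x + x.length < off
  have hE : E.card ≤ 1 := by
    rw [Finset.card_le_one]
    intro x hx y hy
    simp only [E, Finset.mem_filter] at hx hy
    refine huniq s (fun x hx => ⟨(hs x hx).1, (hs x hx).2.1, (hs x hx).2.2.2⟩) x hx.1 y hy.1 ?_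
    have := (hs x hx.1).2.1.2.1
    have := (hs y hy.1).2.1.2.1
    have := h.off_le
    omega
  -- The exceptional repeat is moved to an end shared with no longer substring of `T`. Its gain is
  -- then no longer controlled by the window and is bounded by 2, which is the additive constant 2.
  let f : List α → ℕ := fun x => if s x + x.length < off then t x else s x
  have hf : ∀ x ∈ B, (f x = lo i off T' x ∨ f x = hi i off T' x) ∧
      f x ∈ cr i off T' x ∧ ∀ y ∈ B, ∀ b', (b' = lo i off T' y ∨ b' = hi i off T' y) →
        f x + x.length = b' + y.length → y.length ≤ x.length := by
    intro x hx
    by_cases he : s x + x.length < off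
    · simp only [f, he, if_true]
      refine ⟨(ht x hx).1, (ht x hx).2.1, fun y hy b' hb' e => (ht x hx).2.2.2 y b'
        (hbase y hy).occurs ?_ e⟩
      have hyc := (hbase y hy).nonempty_cr h hT'
      rcases hb' with rfl | rfl
      exacts [(lo_mem hyc).1, (hi_mem hyc).1]
    · simp only [f, he, if_false]
      exact ⟨(hs x hx).1, (hs x hx).2.1, (hs x hx).2.2.2⟩
  have hoff : ∀ x ∈ B, off ≤ f x + x.length := by
    intro x hx
    by_cases he : s x + x.length < off
    · simp only [f, he, if_true]; exact (ht x hx).2.2.1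
    · simp only [f, he, if_false]; omega
  have hsum := (h.card_and_sum_le_of_ends B (fun x => f x + x.length)
    (fun x hx y hy e => huniq f hf x hx y hy e) hoff
    (fun x hx => (hbase x hx).mem_RightM h hT' (hf x hx).2.1 (hoff x hx))
    fun x hx => exists_rightChar_of_mem_N hT' (hbase x hx).mem_N (hf x hx).2.1.1).2
  have hpt : ∀ x ∈ B, weight κ i T T' x ≤
      rdeg T (win T' off (f x + x.length)) + 2 + if s x + x.length < off then 2 else 0 := by
    intro x hx
    have hM := (hbase x hx).mem_N.1.1
    have hcr := (hf x hx).2.1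
    have hsuf : win T' off (f x + x.length) <:+ x := by
      conv_rhs => rw [hcr.1.eq_win]
      exact win_suffix_win hcr.2.2
    have hd : rdeg T' x ≤ rdeg T (win T' off (f x + x.length)) + 2 :=
      (h.rdeg_le_add_two hT' (hbase x hx).mem_N ⟨_, hcr⟩).trans
        (Nat.add_le_add_right (rdeg_le_of_suffix hsuf) 2)
    split_ifs with he
    · have := weight_le_rdeg_add_two (κ := κ) (i := i) (T := T) hM
      omega
    · refine (weight_le hM ?_ hd).trans (by omega)
      rw [(hs x hx).2.2.1]
      simp only [f, he, if_false]
      exact win_suffix_win h.le_off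
  refine (Finset.sum_le_sum hpt).trans ?_
  rw [Finset.sum_add_distrib, Finset.sum_add_distrib, Finset.sum_const, ← Finset.sum_filter,
    Finset.sum_const, smul_eq_mul, smul_eq_mul]
  have : (B.filter fun x => s x + x.length < off).card ≤ 1 := hE
  omega

end

/-! ### Kept repeats and repeats that do not occur in `T` -/

section

variable {d : α} {T T' x y z x₁ x₂ : List α} {i off j b b' l n p p' : ℕ}

theorem Agree.getElem?_eq (h : Agree T T' b b' n) (hp : p' + b = p + b') (hb : b ≤ p)
    (hn : p < b + n) : T[p]? = T'[p']? := by
  have := h (p - b) (by omega)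
  rwa [show b + (p - b) = p by omega, show b' + (p - b) = p' by omega] at this

theorem Agree.leftChar_eq (h : Agree T T' b b' n) (hp : p' + b = p + b') (hb : b < p)
    (hn : p ≤ b + n) : leftChar T p = leftChar T' p' := by
  rw [leftChar_of_pos (by omega), leftChar_of_pos (by omega)]
  exact h.getElem?_eq (by omega) (by omega) (by omega)

theorem Agree.occursAt_shift (h : Agree T T' b b' n) (hz : OccursAt T z p) (hp : p' + b = p + b')
    (hb : b ≤ p) (hn : p + z.length ≤ b + n) (hl : p' + z.length ≤ T'.length) :
    OccursAt T' z p' := by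
  rw [occursAt_iff] at hz ⊢
  refine ⟨hl, fun k hk => ?_⟩
  rw [← hz.2 k hk]
  exact (h.getElem?_eq (by omega) (by omega) (by omega)).symm

/-- `l` is the beginning of the leftmost extension of `T'[b..i)` in `T`. -/
structure IsLeftEnd (T T' : List α) (i b l : ℕ) : Prop where
  le : l ≤ b
  mem_LeftM : win T' l i ∈ LeftM T
  leftExt : LeftExt T (win T' b i) (win T' l i)

theorem Edited.le_length (h : Edited T T' i off j) : i ≤ T'.length := h.le_off.trans h.off_le_length

theorem Edited.occ_win_left (h : Edited T T' i off j) (hb : b ≤ i) :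
    OccursAt T (win T' b i) b :=
  h.occ_left (occursAt_win hb h.le_length) (by rw [length_win h.le_length]; omega)

theorem Edited.exists_isLeftEnd (h : Edited T T' i off j) (hb : b ≤ i) :
    ∃ l, IsLeftEnd T T' i b l := by
  obtain ⟨u, hu, hbu⟩ := exists_leftExt (h.occ_win_left hb).isInfix
  obtain ⟨q, hq, huq⟩ := hbu.2 b (h.occ_win_left hb)
  rw [length_win h.le_length] at hq
  have hle := hbu.1.length_le
  rw [length_win h.le_length] at hle
  have hlen := h.left_le
  have hw : u = win T' q i := by
    have ho : OccursAt T (win T' q i) q := h.occ_win_left (by omega)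
    exact huq.eq_of_length_eq ho (by rw [length_win h.le_length]; omega)
  exact ⟨q, by omega, hw ▸ hu, hw ▸ hbu⟩

theorem IsLeftEnd.occursAt (h : Edited T T' i off j) (hl : IsLeftEnd T T' i b l) (hb : b ≤ i)
    (ho : OccursAt T (win T' b i) p) : b - l ≤ p ∧ OccursAt T (win T' l i) (p - (b - l)) := by
  obtain ⟨q, hq, h'⟩ := hl.leftExt.2 p ho
  rw [length_win h.le_length, length_win h.le_length] at hq
  have := hl.le
  exact ⟨by omega, by rwa [show p - (b - l) = q by omega]⟩

theorem cr_win_prefix (hb : b ∈ cr i off T' x) : win T' b i <+: x := by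
  conv_rhs => rw [hb.1.eq_win]
  exact win_prefix_win hb.2.1

namespace IsAdd

theorem lo_le_left (h : Edited T T' i off j) (hT' : EndsWithMarker d T')
    (hx : IsAdd T T' i off x) : lo i off T' x ≤ i := by
  have := hx.lo_lt_hi h hT'
  have := (hx.hi_mem hT').2.2
  have := h.off_le
  omega

/-- If the rightmost crossing occurrence does not begin beyond the unchanged prefix, then its
part in this prefix also occurs at the leftmost crossing position. -/
theorem occ_win_lo (h : Edited T T' i off j) (hT' : EndsWithMarker d T')
    (hx : IsAdd T T' i off x) :
    OccursAt T (win T' (hi i off T' x) i) (lo i off T' x) := by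
  have hlt := hx.lo_lt_hi h hT'
  have := hx.lo_le_left h hT'
  refine h.occ_left ((hx.lo_mem hT').1.of_prefix (cr_win_prefix (hx.hi_mem hT'))) ?_
  rw [length_win h.le_length]
  omega

/-- The window from `hi` to `i` is a prefix of `x`, so it occurs in the unchanged prefix at `lo` as
well as at `hi`, with different left letters. -/
theorem hi_spec (h : Edited T T' i off j) (hT' : EndsWithMarker d T')
    (hx : IsAdd T T' i off x) (hi' : hi i off T' x ≤ i)
    (hne : leftChar T' (lo i off T' x) ≠ leftChar T' (hi i off T' x)) :
    win T' (hi i off T' x) i ∈ LeftM T ∧ ∃ b b', b ≠ b' ∧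
      OccursAt T (win T' (hi i off T' x) i) b ∧ OccursAt T (win T' (hi i off T' x) i) b' := by
  have h1 := hx.occ_win_lo h hT'
  have h2 := h.occ_win_left hi'
  refine ⟨mem_LeftM_of_leftChar_ne h1 h2 ?_, _, _, (hx.lo_lt_hi h hT').ne, h1, h2⟩
  rwa [h.leftChar_left (hx.lo_le_left h hT'), h.leftChar_left hi']

/-- All occurrences of such a repeat are crossing; were the left letters at the two extremes equal,
periodicity would make all of them equal. -/
theorem hi_spec_of_not_isInfix (h : Edited T T' i off j) (hT' : EndsWithMarker d T')
    (hx : IsAdd T T' i off x) (hxT : ¬ x <:+: T) :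
    hi i off T' x ≤ i ∧ win T' (hi i off T' x) i ∈ LeftM T ∧ ∃ b b', b ≠ b' ∧
      OccursAt T (win T' (hi i off T' x) i) b ∧ OccursAt T (win T' (hi i off T' x) i) b' := by
  have hRm := hx.hi_mem hT'
  have hlt := hx.lo_lt_hi h hT'
  have hle : hi i off T' x ≤ i := by
    have := (h.straddles hRm.1 hxT).1
    have := h.off_le
    omega
  refine ⟨hle, hx.hi_spec h hT' hle fun e => ?_⟩
  obtain ⟨c, hc⟩ := hRm.1.leftChar_ne_none (by omega)
  obtain ⟨b, hb, hne⟩ := exists_leftChar_ne hx.mem_N.1.1.1 c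
  have hs := h.straddles hb hxT
  have hbc : b ∈ cr i off T' x := ⟨hb, by omega, by omega⟩
  rcases (lo_le hbc).eq_or_lt with heq | hgt
  · exact hne (by rw [← heq, e, hc])
  · exact hne (by rw [h.leftChar_eq_hi hbc hgt, hc])

/-- Two additional repeats with the same rightmost crossing position: the shorter one does
not cross at the leftmost crossing position of the longer one. -/
theorem not_mem_cr_of_hi_eq (h : Edited T T' i off j) (hT' : EndsWithMarker d T')
    (hx : IsAdd T T' i off x) (hy : IsAdd T T' i off y) (he : hi i off T' x = hi i off T' y)
    (hlt : x.length < y.length) :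
    OccursAt T' x (lo i off T' y) ∧ lo i off T' y ∉ cr i off T' x := by
  have hLy := (hy.lo_mem hT').1
  have hRy := (hy.hi_mem hT').1
  have ag := hRy.agree hLy
  have hRx := (hx.hi_mem hT').1
  have hlxy := hy.lo_lt_hi h hT'
  have := hLy.le
  have hxy : OccursAt T' x (lo i off T' y) :=
    ag.occursAt_shift hRx (by omega) (by omega) (by omega) (by omega)
  refine ⟨hxy, fun hc => hx.rightChar_ne h hT' ?_⟩
  rw [← h.rightChar_eq_lo hc (by omega)]
  exact (ag.getElem?_eq (by omega) (by omega) (by omega)).symm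

theorem length_le_of_hi_eq_of_not_isInfix (h : Edited T T' i off j) (hT' : EndsWithMarker d T')
    (hx : IsAdd T T' i off x) (hy : IsAdd T T' i off y) (hxT : ¬ x <:+: T)
    (he : hi i off T' x = hi i off T' y) : y.length ≤ x.length := by
  by_contra hlt
  obtain ⟨h1, h2⟩ := hx.not_mem_cr_of_hi_eq h hT' hy he (by omega)
  have := h.straddles h1 hxT
  exact h2 ⟨h1, by omega, by omega⟩

end IsAdd

namespace IsKept

theorem not_isInfix (h : Edited T T' i off j) (hT' : EndsWithMarker d T')
    (hx : IsKept T T' i off x) :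
    ¬ win T' (lo i off T' x) (lo i off T' x + x.length + 1) <:+: T := by
  intro hn
  have hLm := hx.isAdd.lo_mem hT'
  have hRm := hx.isAdd.hi_mem hT'
  obtain ⟨aL, haL⟩ := exists_rightChar_of_mem_N hT' hx.isAdd.mem_N hLm.1
  obtain ⟨aR, haR⟩ := exists_rightChar_of_mem_N hT' hx.isAdd.mem_N hRm.1
  have hr := hx.right
  rw [win_succ_eq hLm.1 haL] at hn
  rw [win_succ_eq hRm.1 haR] at hr
  obtain ⟨c, hc⟩ := exists_rightChar_of_notMem_RightM hx.occurs hx.isAdd.notRight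
  obtain ⟨b, hb, e⟩ := append_singleton_infix_iff.1 hn
  obtain ⟨b', hb', e'⟩ := append_singleton_infix_iff.1 hr
  exact hx.isAdd.rightChar_ne h hT' (by rw [haL, haR, ← e, ← e', hc b hb, hc b' hb'])

theorem exists_leftChar (h : Edited T T' i off j) (hT' : EndsWithMarker d T')
    (hx : IsKept T T' i off x) : ∃ c, (∀ b, OccursAt T x b → leftChar T b = some c) ∧
      leftChar T' (lo i off T' x) = some c ∧ leftChar T' (hi i off T' x) ≠ some c := by
  obtain ⟨c, hc⟩ := exists_leftChar_of_notMem_LeftM hx.occurs hx.isAdd.notLeft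
  have hLm := hx.isAdd.lo_mem hT'
  have hL : leftChar T' (lo i off T' x) = some c := by
    obtain ⟨a, ha⟩ := hLm.1.leftChar_ne_none (by have := hx.pos; omega)
    have hl := hx.left
    rw [win_pred_eq hx.pos hLm.1 ha] at hl
    obtain ⟨b, hb, e⟩ := cons_infix_iff.1 hl
    rw [ha, ← e, hc b hb]
  refine ⟨c, hc, hL, ?_⟩
  obtain ⟨-, hn | hn⟩ := h.newLeft_lo_or_hi hc hx.isAdd.mem_N.1.1.1
  · exact absurd hL hn
  · exact hn

theorem leftChar_ne (h : Edited T T' i off j) (hT' : EndsWithMarker d T')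
    (hx : IsKept T T' i off x) :
    leftChar T' (lo i off T' x) ≠ leftChar T' (hi i off T' x) := by
  obtain ⟨c, -, h1, h2⟩ := hx.exists_leftChar h hT'
  rw [h1]
  exact h2.symm

/-- An occurrence of `x` in `T` begins with the window from `lo` to `i`, which always extends to the
left end `l`. -/
theorem infix_of_isLeftEnd (h : Edited T T' i off j) (hT' : EndsWithMarker d T')
    (hx : IsKept T T' i off x) (hl : IsLeftEnd T T' i (lo i off T' x) l) :
    win T' l (lo i off T' x + x.length) <:+: T := by
  obtain ⟨q, hq⟩ := infix_iff_exists_occursAt.1 hx.occurs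
  have hLm := hx.isAdd.lo_mem hT'
  have hLi := hx.isAdd.lo_le_left h hT'
  obtain ⟨h1, h2⟩ := hl.occursAt h hLi (hq.of_prefix (cr_win_prefix hLm))
  have hle := hl.le
  refine OccursAt.isInfix (b := q - (lo i off T' x - l)) ?_
  have hlen := hLm.1.le
  have := hLm.2.1
  have hql := hq.le
  rw [occursAt_iff, length_win hlen]
  refine ⟨by omega, fun k hk => ?_⟩
  rw [getElem?_win (by omega)]
  by_cases hk' : l + k < lo i off T' x
  · have := (occursAt_iff.1 h2).2 k (by rw [length_win h.le_length]; omega)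
    rw [this, getElem?_win (by omega)]
  · exact (hq.agree hLm.1).getElem?_eq (by omega) (by omega) (by omega)

theorem not_isInfix_of_isLeftEnd (h : Edited T T' i off j) (hT' : EndsWithMarker d T')
    (hx : IsKept T T' i off x) (hl : l ≤ lo i off T' x) :
    ¬ win T' l (lo i off T' x + x.length + 1) <:+: T := fun hn =>
  hx.not_isInfix h hT' ((win_suffix_win hl).isInfix.trans hn)

/-- The window from `l` to the end of the leftmost occurrence lies in `T`, but with one more letter
it does not; so `l` determines this end. -/
theorem end_le_of_isLeftEnd (h : Edited T T' i off j) (hT' : EndsWithMarker d T')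
    (hx : IsKept T T' i off x) (hy : IsKept T T' i off y)
    (hlx : IsLeftEnd T T' i (lo i off T' x) l) (hly : IsLeftEnd T T' i (lo i off T' y) l) :
    lo i off T' x + x.length ≤ lo i off T' y + y.length := by
  by_contra hlt
  exact hy.not_isInfix_of_isLeftEnd h hT' hly.le
    ((win_prefix_win (by omega)).isInfix.trans (hx.infix_of_isLeftEnd h hT' hlx))

theorem end_eq_of_isLeftEnd (h : Edited T T' i off j) (hT' : EndsWithMarker d T')
    (hx : IsKept T T' i off x) (hy : IsKept T T' i off y)
    (hlx : IsLeftEnd T T' i (lo i off T' x) l) (hly : IsLeftEnd T T' i (lo i off T' y) l) :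
    lo i off T' x + x.length = lo i off T' y + y.length :=
  (hx.end_le_of_isLeftEnd h hT' hy hlx hly).antisymm (hy.end_le_of_isLeftEnd h hT' hx hly hlx)

/-- The rightmost position of a repeat that does not occur in `T` is not a left end. -/
theorem hi_ne_of_not_isInfix (h : Edited T T' i off j) (hT' : EndsWithMarker d T')
    (hx : IsKept T T' i off x) (hl : IsLeftEnd T T' i (lo i off T' x) l)
    (hy : IsAdd T T' i off y) (hyT : ¬ y <:+: T) : hi i off T' y ≠ l := by
  intro he
  have hLm := hx.isAdd.lo_mem hT'
  have hLy := hy.lo_mem hT'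
  have hRy := hy.hi_mem hT'
  have hlt := hy.lo_lt_hi h hT'
  have hle := hl.le
  have hlong : lo i off T' x + x.length + 1 ≤ hi i off T' y + y.length := by
    by_contra hn
    refine hyT (List.IsInfix.trans ?_ (hx.infix_of_isLeftEnd h hT' hl))
    rw [hRy.1.eq_win, he]
    exact (win_prefix_win (by omega)).isInfix
  obtain ⟨aL, haL⟩ := exists_rightChar_of_mem_N hT' hx.isAdd.mem_N hLm.1
  have hn := hx.not_isInfix h hT'
  rw [win_succ_eq hLm.1 haL] at hn
  have := hLy.1.le
  -- Since `y` at `l` covers `x ++ [aL]`, the latter reappears inside `y` at `lo`. It does not occur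
  -- in `T`, so there it still meets the edit, and `x` crosses to the left of its leftmost crossing
  -- position.
  have hsh : OccursAt T' (x ++ [aL]) (lo i off T' x - (hi i off T' y - lo i off T' y)) :=
    (hRy.1.agree hLy.1).occursAt_shift (occursAt_append_singleton.2 ⟨hLm.1, haL⟩)
      (by omega) (by omega) (by simp; omega) (by simp; omega)
  have hs := h.straddles hsh hn
  simp only [List.length_append, List.length_singleton] at hs
  have := lo_le (i := i) (off := off) (T' := T') (x := x)
    ⟨(occursAt_append_singleton.1 hsh).1, by omega, by omega⟩
  omega

/-- The rightmost position of a kept repeat is not a left end. -/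
theorem hi_ne_of_isLeftEnd (h : Edited T T' i off j) (hT' : EndsWithMarker d T')
    (hx : IsKept T T' i off x) (hy : IsKept T T' i off y)
    (hl : IsLeftEnd T T' i (lo i off T' y) l) : hi i off T' x ≠ l := by
  intro he
  have hLx := hx.isAdd.lo_mem hT'
  have hRx := hx.isAdd.hi_mem hT'
  have hLy := hy.isAdd.lo_mem hT'
  have hRy := hy.isAdd.hi_mem hT'
  have hlx := hx.isAdd.lo_lt_hi h hT'
  have hly := hy.isAdd.lo_lt_hi h hT'
  have hle := hl.le
  have hLyi := hy.isAdd.lo_le_left h hT'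
  have hlong : hi i off T' x + x.length + 1 ≤ lo i off T' y + y.length := by
    by_contra hn
    refine hy.not_isInfix_of_isLeftEnd h hT' hl.le ((win_prefix_win ?_).isInfix.trans
      (he ▸ hx.right))
    omega
  have h1 := hRx.2
  have h2 := hRy.2
  have h3 := hLx.2
  have hoff := h.off_le
  have hlenx := hRx.1.le
  have hleny := hRy.1.le
  -- This window lies inside `x` at `hi` and is a prefix of `y`. It therefore also occurs further
  -- left by `hi - lo` of `x`, and at the rightmost position of `y`. Periodicity then equates the
  -- two right letters of `x`.
  have hw : OccursAt T' (win T' (lo i off T' y) (hi i off T' x + x.length)) (lo i off T' y) :=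
    occursAt_win (by omega) hRx.1.le
  have hlw := length_win (b := lo i off T' y) hRx.1.le
  have o1 : OccursAt T' (win T' (lo i off T' y) (hi i off T' x + x.length))
      (lo i off T' y - (hi i off T' x - lo i off T' x)) :=
    (hRx.1.agree hLx.1).occursAt_shift hw (by omega) (by omega) (by omega) (by omega)
  have o3 : OccursAt T' (win T' (lo i off T' y) (hi i off T' x + x.length)) (hi i off T' y) :=
    (hLy.1.agree hRy.1).occursAt_shift hw (by omega) (by omega) (by omega) (by omega)
  have := rightChar_eq_of_three o1 hw o3 (by omega) (by omega) (by omega)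
  rw [hlw] at this
  refine hx.isAdd.rightChar_ne h hT' ?_
  rwa [show lo i off T' y - (hi i off T' x - lo i off T' x) +
      (hi i off T' x + x.length - lo i off T' y) = lo i off T' x + x.length by omega,
    show lo i off T' y + (hi i off T' x + x.length - lo i off T' y) =
      hi i off T' x + x.length by omega] at this

end IsKept

/-- Two kept repeats with the same left end, of which `x₁` is the shorter one. -/
structure Conflict (T T' : List α) (i off l : ℕ) (x₁ x₂ : List α) : Prop where
  kept₁ : IsKept T T' i off x₁
  kept₂ : IsKept T T' i off x₂
  left₁ : IsLeftEnd T T' i (lo i off T' x₁) l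
  left₂ : IsLeftEnd T T' i (lo i off T' x₂) l
  lt : x₁.length < x₂.length

namespace Conflict

theorem end_eq (h : Edited T T' i off j) (hT' : EndsWithMarker d T')
    (hc : Conflict T T' i off l x₁ x₂) :
    lo i off T' x₁ + x₁.length = lo i off T' x₂ + x₂.length :=
  hc.kept₁.end_eq_of_isLeftEnd h hT' hc.kept₂ hc.left₁ hc.left₂

/-- Every occurrence in `T` of the window from `lo` of `x₁` to `i` extends left to `l`. A copy of
that window inside the extension, starting earlier, would therefore produce ever earlier
occurrences. -/
theorem not_occursAt (h : Edited T T' i off j) (hT' : EndsWithMarker d T')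
    (hc : Conflict T T' i off l x₁ x₂) (hb : lo i off T' x₂ ≤ b) (hb' : b < lo i off T' x₁) :
    ¬ OccursAt T' (win T' (lo i off T' x₁) i) b := by
  intro ho
  have hi1 := hc.kept₁.isAdd.lo_le_left h hT'
  have hlen := length_win (b := lo i off T' x₁) h.le_length
  have hleni := h.le_length
  have hTlen := h.left_le
  have hl := hc.left₂.le
  set L₁ := lo i off T' x₁
  set L₂ := lo i off T' x₂
  have key : ∀ p, ¬ OccursAt T (win T' L₁ i) p := by
    intro p
    induction p using Nat.strong_induction_on with
    | _ p ih =>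
      intro hp
      obtain ⟨h1, h2⟩ := hc.left₁.occursAt h hi1 hp
      have hle := h2.le
      have hll := length_win (b := l) h.le_length
      have ag : Agree T' T l (p - (L₁ - l)) (i - l) := by
        have := (occursAt_win (b := l) (e := i) (by omega) h.le_length).agree h2
        rwa [hll] at this
      refine ih (p - (L₁ - b)) (by omega) (ag.occursAt_shift ho ?_ ?_ ?_ ?_) <;> omega
  exact key _ (h.occ_win_left hi1)

theorem hi_lt_hi (h : Edited T T' i off j) (hT' : EndsWithMarker d T')
    (hc : Conflict T T' i off l x₁ x₂) : hi i off T' x₁ < hi i off T' x₂ := by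
  by_contra hle
  have hL₁ := hc.kept₁.isAdd.lo_mem hT'
  have hL₂ := hc.kept₂.isAdd.lo_mem hT'
  have hR₁ := hc.kept₁.isAdd.hi_mem hT'
  have hR₂ := hc.kept₂.isAdd.hi_mem hT'
  have he := hc.end_eq h hT'
  have hlt := hc.lt
  have hlt₂ := hc.kept₂.isAdd.lo_lt_hi h hT'
  have hlt₁ := hc.kept₁.isAdd.lo_lt_hi h hT'
  have ag := hL₂.1.agree hR₂.1
  have hlen := hR₂.1.le
  have hlen' := hL₂.1.le
  have hnot := fun b => hc.not_occursAt (b := b) h hT'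
  have hi1 := hc.kept₁.isAdd.lo_le_left h hT'
  have hlw := length_win (b := lo i off T' x₁) h.le_length
  have hpre := hR₁.1.of_prefix (cr_win_prefix hL₁)
  have h1 := hL₁.2
  have h2 := hR₂.2
  obtain ⟨c, -, hcL, hcR⟩ := hc.kept₁.exists_leftChar h hT'
  -- Because the two leftmost ends coincide, `x₁` is a suffix of `x₂` and occurs inside `x₂` at its
  -- rightmost position. If that copy crossed, its left letter would be both old and new.
  have hfar : off < hi i off T' x₂ + (lo i off T' x₁ - lo i off T' x₂) := by
    by_contra hn
    have ho : OccursAt T' x₁ (hi i off T' x₂ + (lo i off T' x₁ - lo i off T' x₂)) :=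
      ag.occursAt_shift hL₁.1 (by omega) (by omega) (by omega) (by omega)
    refine hcR ?_
    rw [← h.leftChar_eq_hi ⟨ho, by omega, by omega⟩ (by omega), ← hcL]
    exact (ag.leftChar_eq (by omega) (by omega) (by omega)).symm
  have h3 := hR₁.2
  refine hnot (lo i off T' x₂ + (hi i off T' x₁ - hi i off T' x₂)) (by omega) (by omega) ?_
  exact (hR₂.1.agree hL₂.1).occursAt_shift hpre (by omega) (by omega) (by omega) (by omega)

/-- No longer additional repeat has the same rightmost crossing position as `x₁`. -/
theorem length_le_of_hi_eq (h : Edited T T' i off j) (hT' : EndsWithMarker d T')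
    (hc : Conflict T T' i off l x₁ x₂) (hy : IsAdd T T' i off y)
    (hhi : hi i off T' y = hi i off T' x₁) : y.length ≤ x₁.length := by
  by_contra hlt
  obtain ⟨ho, hncr⟩ := hc.kept₁.isAdd.not_mem_cr_of_hi_eq h hT' hy hhi.symm (by omega)
  have hL₁ := hc.kept₁.isAdd.lo_mem hT'
  have hL₂ := hc.kept₂.isAdd.lo_mem hT'
  have hR₂ := hc.kept₂.isAdd.hi_mem hT'
  have hLy := hy.lo_mem hT'
  have hRy := hy.hi_mem hT'
  have he := hc.end_eq h hT'
  have hlt₁₂ := hc.lt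
  have hRR := hc.hi_lt_hi h hT'
  have hlty := hy.lo_lt_hi h hT'
  have hlt₂ := hc.kept₂.isAdd.lo_lt_hi h hT'
  have hnear : lo i off T' y + x₁.length < i := by
    by_contra hn
    exact hncr ⟨ho, by omega, hLy.2.2⟩
  have hLyL₂ : lo i off T' y < lo i off T' x₂ := by
    by_contra hn
    have := hL₁.2
    exact hc.not_occursAt h hT' (by omega) (by omega) (ho.of_prefix (cr_win_prefix hL₁))
  obtain ⟨c, hcT, hcL, hcR⟩ := hc.kept₂.exists_leftChar h hT'
  have hi1 := hc.kept₁.isAdd.lo_le_left h hT'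
  have ag := hLy.1.agree hRy.1
  have ag' := hRy.1.agree hLy.1
  have agx := hL₂.1.agree hR₂.1
  have agx' := hR₂.1.agree hL₂.1
  have l1 := hRy.1.le
  have l2 := hR₂.1.le
  have l3 := hL₂.1.le
  have l4 := hLy.1.le
  have c1 := hL₂.2
  have c2 := hR₂.2
  have c3 := hLy.2
  have hoff := h.off_le
  -- `M` is the image of the rightmost position of `x₂` when `y` is shifted from `hi` to `lo`; its
  -- left letter is not `c`. Each position of `M` relative to the leftmost position of `x₂`
  -- contradicts this, mostly through three close occurrences of a window.
  obtain ⟨M, hM⟩ : ∃ M, M + hi i off T' y = hi i off T' x₂ + lo i off T' y :=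
    ⟨hi i off T' x₂ - hi i off T' y + lo i off T' y, by omega⟩
  have hlM : leftChar T' (hi i off T' x₂) = leftChar T' M :=
    ag'.leftChar_eq (by omega) (by omega) (by omega)
  rcases lt_trichotomy M (lo i off T' x₂) with hlt | heq | hgt
  · by_cases hfit : M + x₂.length ≤ lo i off T' y + y.length
    · have hoM : OccursAt T' x₂ M :=
        ag'.occursAt_shift hR₂.1 (by omega) (by omega) (by omega) (by omega)
      by_cases hcross : i ≤ M + x₂.length
      · have := lo_le (i := i) (off := off) ⟨hoM, hcross, by omega⟩
        omega
      · have := hcT M (h.occ_left hoM (by omega))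
        rw [h.leftChar_left (by omega), ← hlM] at this
        exact hcR this
    · have ow := occursAt_win (b := M) (e := lo i off T' y + y.length) (by omega) l4
      have hlw := length_win (b := M) l4
      have o3 : OccursAt T' (win T' M (lo i off T' y + y.length)) (hi i off T' x₂) :=
        ag.occursAt_shift ow (by omega) (by omega) (by omega) (by omega)
      have o2 : OccursAt T' (win T' M (lo i off T' y + y.length)) (lo i off T' x₂) :=
        agx'.occursAt_shift o3 (by omega) (by omega) (by omega) (by omega)
      have := leftChar_eq_of_three ow o2 o3 (by omega) (by omega) (by omega)
      exact hcR (by rw [← this, hcL])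
  · exact hcR (by rw [hlM, heq, hcL])
  · obtain ⟨f, hf⟩ : ∃ f, f = min (lo i off T' x₂ + x₂.length) (lo i off T' y + y.length) := ⟨_, rfl⟩
    have ow := occursAt_win (T := T') (b := lo i off T' x₂) (e := f) (by omega) (by omega)
    have hlw := length_win (T := T') (b := lo i off T' x₂) (e := f) (by omega)
    obtain ⟨q, hq⟩ : ∃ q, q + lo i off T' y = lo i off T' x₂ + hi i off T' y :=
      ⟨lo i off T' x₂ - lo i off T' y + hi i off T' y, by omega⟩
    have o2 : OccursAt T' (win T' (lo i off T' x₂) f) q :=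
      ag.occursAt_shift ow (by omega) (by omega) (by omega) (by omega)
    have o3 : OccursAt T' (win T' (lo i off T' x₂) f) (hi i off T' x₂) :=
      agx.occursAt_shift ow (by omega) (by omega) (by omega) (by omega)
    have := leftChar_eq_of_three ow o2 o3 (by omega) (by omega) (by omega)
    refine hcR ?_
    rw [← this, ← hcL]
    exact (ag.leftChar_eq (by omega) (by omega) (by omega)).symm

end Conflict

end

section

variable {d : α} {κ : EditKind} {T T' x y : List α} {i off j l : ℕ}

/-! ### Choosing starts injectively -/

namespace IsKept

theorem length_le_of_once (h : Edited T T' i off j) (hT' : EndsWithMarker d T')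
    (hx : IsKept T T' i off x) (ho : ∀ b b', OccursAt T (win T' (lo i off T' x) i) b →
      OccursAt T (win T' (lo i off T' x) i) b' → b = b')
    (hy : IsAdd T T' i off y) (hhi : hi i off T' y = hi i off T' x) : y.length ≤ x.length := by
  by_contra hlt
  obtain ⟨hxy, hncr⟩ := hx.isAdd.not_mem_cr_of_hi_eq h hT' hy hhi.symm (by omega)
  have hLm := hx.isAdd.lo_mem hT'
  have hnear : lo i off T' y + x.length < i := by
    by_contra hn
    exact hncr ⟨hxy, by omega, (hy.lo_mem hT').2.2⟩
  have := ho _ _ ((h.occ_left hxy hnear.le).of_prefix (cr_win_prefix hLm))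
    (h.occ_win_left (hx.isAdd.lo_le_left h hT'))
  exact hncr (this ▸ hLm)

/-- An occurrence starting beyond `i` lies in the unchanged suffix and repeats the window from `lo`
to `i`. Uniqueness would force this window to be empty, but the empty string occurs twice in a
non-empty text. -/
theorem hi_le_of_once (h : Edited T T' i off j) (hT : EndsWithMarker d T)
    (hT' : EndsWithMarker d T') (hx : IsKept T T' i off x)
    (ho : ∀ b b', OccursAt T (win T' (lo i off T' x) i) b →
      OccursAt T (win T' (lo i off T' x) i) b' → b = b') : hi i off T' x ≤ i := by
  by_contra hgt
  have hLm := hx.isAdd.lo_mem hT'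
  have hRm := hx.isAdd.hi_mem hT'
  have hoff := h.off_le
  have hRo := hRm.2.2
  have hj := h.le_j
  have hLi := hx.isAdd.lo_le_left h hT'
  have h1 := (h.occ_right hRm.1 (by omega)).of_prefix (cr_win_prefix hLm)
  have he := ho _ _ h1 (h.occ_win_left hLi)
  have hlw := length_win (b := lo i off T' x) h.le_length
  have hnil : win T' (lo i off T' x) i = [] := List.eq_nil_of_length_eq_zero (by omega)
  rw [hnil] at ho
  have hpos : 1 ≤ T.length := by
    obtain ⟨w, -, rfl⟩ := hT
    simp
  exact absurd (ho 0 1 ((occursAt_iff).2 ⟨by simp, by simp⟩) (occursAt_iff.2 ⟨by simpa, by simp⟩))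
    (by simp)

end IsKept

/-- Kept repeats and additional repeats that do not occur in `T` are few. -/
theorem Edited.card_kept_le (h : Edited T T' i off j) (hT : EndsWithMarker d T)
    (hT' : EndsWithMarker d T') (A : Finset (List α))
    (hA : ∀ x ∈ A, IsAdd T T' i off x ∧ (x <:+: T → IsKept T T' i off x)) :
    A.card ≤ (MR T).ncard := by
  classical
  have hex : ∀ x, ∃ l, x ∈ A → IsLeftEnd T T' i (lo i off T' x) l := fun x => by
    by_cases hx : x ∈ A
    · obtain ⟨l, hl⟩ := h.exists_isLeftEnd ((hA x hx).1.lo_le_left h hT')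
      exact ⟨l, fun _ => hl⟩
    · exact ⟨0, fun h => absurd h hx⟩
  choose e he using hex
  let Once : List α → Prop := fun x => ∀ b b', OccursAt T (win T' (lo i off T' x) i) b →
      OccursAt T (win T' (lo i off T' x) i) b' → b = b'
  let Low : List α → Prop := fun x => ∃ y ∈ A, y <:+: T ∧ x.length < y.length ∧ e y = e x
  -- The left end is used only when its window occurs twice in `T` and no longer repeat claims it.
  -- In every other case the rightmost crossing start is used, and then no longer repeat of `A` has
  -- the same one.
  let f : List α → ℕ := fun x => if x <:+: T ∧ ¬ Once x ∧ ¬ Low x then e x else hi i off T' x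
  have hconf : ∀ x ∈ A, x <:+: T → Low x → ∃ y l, Conflict T T' i off l x y := by
    rintro x hx hxT ⟨y, hy, hyT, hlt, hey⟩
    exact ⟨y, e x, (hA x hx).2 hxT, (hA y hy).2 hyT, he x hx, hey ▸ he y hy, hlt⟩
  have hspec : ∀ x ∈ A, f x ≤ i ∧ win T' (f x) i ∈ LeftM T ∧ ∃ b b', b ≠ b' ∧
      OccursAt T (win T' (f x) i) b ∧ OccursAt T (win T' (f x) i) b' := by
    intro x hx
    by_cases hxT : x <:+: T
    · have hK := (hA x hx).2 hxT
      by_cases hs : ¬ Once x ∧ ¬ Low x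
      · simp only [f, hxT, hs, true_and, not_false_eq_true, if_true]
        have hl := he x hx
        have hLi := hK.isAdd.lo_le_left h hT'
        refine ⟨hl.le.trans hLi, hl.mem_LeftM, ?_⟩
        have hs1 := hs.1
        simp only [Once] at hs1
        push Not at hs1
        obtain ⟨b, b', hb, hb', hne⟩ := hs1
        obtain ⟨h1, h2⟩ := hl.occursAt h hLi hb
        obtain ⟨h3, h4⟩ := hl.occursAt h hLi hb'
        exact ⟨_, _, by omega, h2, h4⟩
      · simp only [f, hs, and_false, if_false]
        have hle : hi i off T' x ≤ i := by
          rw [not_and_or, not_not, not_not] at hs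
          rcases hs with hs | hs
          · exact hK.hi_le_of_once h hT hT' hs
          · obtain ⟨y, l, hc⟩ := hconf x hx hxT hs
            have := hc.hi_lt_hi h hT'
            have := (hc.kept₂.isAdd.hi_mem hT').2.2
            have := h.off_le
            omega
        exact ⟨hle, hK.isAdd.hi_spec h hT' hle (hK.leftChar_ne h hT')⟩
    · simp only [f, hxT, false_and, if_false]
      exact (hA x hx).1.hi_spec_of_not_isInfix h hT' hxT
  have hne : ∀ x ∈ A, ∀ y ∈ A, y <:+: T → hi i off T' x ≠ e y := by
    intro x hx y hy hyT
    by_cases hxT : x <:+: T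
    · exact ((hA x hx).2 hxT).hi_ne_of_isLeftEnd h hT' ((hA y hy).2 hyT) (he y hy)
    · exact ((hA y hy).2 hyT).hi_ne_of_not_isInfix h hT' (he y hy) (hA x hx).1 hxT
  have hle : ∀ x ∈ A, ∀ y ∈ A, ¬ (x <:+: T ∧ ¬ Once x ∧ ¬ Low x) →
      hi i off T' y = hi i off T' x → y.length ≤ x.length := by
    intro x hx y hy hs hhi
    by_cases hxT : x <:+: T
    · have hs' : Once x ∨ Low x := by
        by_contra hn
        exact hs ⟨hxT, not_or.1 hn⟩
      rcases hs' with hs' | hs'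
      · exact ((hA x hx).2 hxT).length_le_of_once h hT' hs' (hA y hy).1 hhi
      · obtain ⟨z, l, hc⟩ := hconf x hx hxT hs'
        exact hc.length_le_of_hi_eq h hT' (hA y hy).1 hhi
    · exact (hA x hx).1.length_le_of_hi_eq_of_not_isInfix h hT' (hA y hy).1 hxT hhi.symm
  refine (h.card_le_of_starts A f ?_ (fun x hx => (hspec x hx).1) fun x hx => (hspec x hx).2.1).2
    fun x hx => (hspec x hx).2.2
  intro x hx y hy hf
  rw [Finset.mem_coe] at hx hy
  -- Equal left ends give equal ends and equal lengths; a left end never equals a rightmost start;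
  -- equal rightmost starts give equal lengths.
  by_cases hsx : x <:+: T ∧ ¬ Once x ∧ ¬ Low x <;> by_cases hsy : y <:+: T ∧ ¬ Once y ∧ ¬ Low y
  · simp only [f, hsx, hsy, and_self, not_false_eq_true, if_true] at hf
    have h1 := hsx.2.2
    have h2 := hsy.2.2
    simp only [Low, not_exists, not_and] at h1 h2
    have h3 := h1 y hy hsy.1
    have h4 := h2 x hx hsx.1
    have hlen : x.length = y.length := by
      rcases lt_trichotomy x.length y.length with hlt | heq | hlt
      · exact absurd hf.symm (h3 hlt)
      · exact heq
      · exact absurd hf (h4 hlt)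
    have hend := ((hA x hx).2 hsx.1).end_eq_of_isLeftEnd h hT' ((hA y hy).2 hsy.1)
      (he x hx) (hf ▸ he y hy)
    have hox := ((hA x hx).1.lo_mem hT').1
    rw [show lo i off T' x = lo i off T' y by omega] at hox
    exact hox.eq_of_length_eq ((hA y hy).1.lo_mem hT').1 hlen
  · simp only [f, hsx, hsy, and_self, not_false_eq_true, if_true, if_false] at hf
    exact absurd hf.symm (hne y hy x hx hsx.1)
  · simp only [f, hsx, hsy, and_self, not_false_eq_true, if_true, if_false] at hf
    exact absurd hf (hne x hx y hy hsy.1)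
  · simp only [f, hsx, hsy, if_false] at hf
    have hlen := (hle y hy x hx hsy hf).antisymm (hle x hx y hy hsx hf.symm)
    have hox := ((hA x hx).1.hi_mem hT').1
    have hoy := ((hA y hy).1.hi_mem hT').1
    rw [hf] at hox
    exact hox.eq_of_length_eq hoy hlen

/-! ### The size of the edited graph -/

theorem rdeg_self (T : List α) : rdeg T T = 0 := by
  unfold rdeg
  have : rightSet T T = ∅ := by
    ext a
    simp only [rightSet, Set.mem_ofPred_eq, Set.mem_empty_iff_false, iff_false]
    intro hn
    have := hn.length_le
    simp at this
  rw [this, Set.ncard_empty]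

theorem Edited.size_add_le (h : Edited T T' i off j) (hT : EndsWithMarker d T)
    (hT' : EndsWithMarker d T') (hC : ∀ b e, b < e → (Crosses κ i b e ↔ i ≤ e ∧ b ≤ off)) :
    size T' + (Nmid κ i T T').ncard + 2 * (Nless κ i T T').ncard ≤
      2 * size T + 5 * (MR T).ncard + (N₂ T T').ncard + 3 := by
  classical
  have hNfin : (N T T').Finite := (finite_MaxSub T').subset fun x hx => hx.1.1
  have hBfin : (N₁ T T' ∪ Nbase κ i T T').Finite := hNfin.subset (by
    rintro x (hx | hx)
    exacts [hx.1, hx.1.1])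
  have h2fin : (N₂ T T').Finite := hNfin.subset fun x hx => hx.1
  have hafin : (Nadd κ i T T').Finite := hNfin.subset fun x hx => hx.1.1
  let S := (finite_MaxSub T').toFinset.filter fun x => x ∈ MaxSub T
  let B := hBfin.toFinset
  let A := h2fin.toFinset
  let Q := hafin.toFinset.filter fun x => x <:+: T ∧ ¬ IsKept T T' i off x
  let K := hafin.toFinset.filter fun x => ¬ (x <:+: T ∧ ¬ IsKept T T' i off x)
  have mB : ∀ x, x ∈ B ↔ x ∈ N₁ T T' ∪ Nbase κ i T T' := fun x => Set.Finite.mem_toFinset _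
  have mA : ∀ x, x ∈ A ↔ x ∈ N₂ T T' := fun x => Set.Finite.mem_toFinset _
  have ma : ∀ x, x ∈ hafin.toFinset ↔ IsAdd T T' i off x := fun x => by
    rw [Set.Finite.mem_toFinset, mem_Nadd_iff hC]
  have hQ : ∀ x ∈ Q, IsAdd T T' i off x ∧ x <:+: T ∧ ¬ IsKept T T' i off x := fun x hx => by
    simpa only [Q, Finset.mem_filter, ma] using hx
  have hI := h.sum_rdeg_le hT' S A Q (fun x hx => (Finset.mem_filter.1 hx).2)
    (fun x hx => (mA x).1 hx) hQ
  have hII := h.sum_weight_le hT' hC B fun x hx => (mB x).1 hx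
  have hBadd : Disjoint B hafin.toFinset := Finset.disjoint_left.2 fun x hx hx' => by
    rw [mB] at hx
    rw [Set.Finite.mem_toFinset] at hx'
    rcases hx with hx | hx
    · exact hx'.1.2 (Or.inl hx)
    · exact hx.2 hx'
  have hIII := h.card_add_card_le hT' B Q (fun x hx => isBase_of_mem h hC ((mB x).1 hx))
    (hBadd.mono_right (Finset.filter_subset _ _)) hQ
  have hIV := h.card_kept_le hT hT' K fun x hx => by
    simp only [K, Finset.mem_filter, ma, not_and, not_not] at hx
    exact hx
  have hcardA : A.card = (N₂ T T').ncard := (Set.ncard_eq_toFinset_card _ h2fin).symm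
  have hadd : ∑ x ∈ hafin.toFinset, rdeg T' x ≤ 2 * (Q.card + K.card) := by
    have : Q.card + K.card = hafin.toFinset.card := Finset.card_filter_add_card_filter_not _
    rw [this, mul_comm]
    exact Finset.sum_le_card_nsmul _ _ _ fun x hx => ((ma x).1 hx).rdeg_le h hT'
  have hmid : ∑ x ∈ B, (if x ∈ Nmid κ i T T' then 1 else 0) = (Nmid κ i T T').ncard := by
    rw [Finset.sum_boole, ← Set.ncard_coe_finset, Nat.cast_id]
    congr 1
    ext x
    simp only [Finset.coe_filter, mB, Set.mem_ofPred_eq]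
    exact ⟨fun hx => hx.2, fun hx => ⟨hx.1, hx⟩⟩
  have hless : ∑ x ∈ B, (if x ∈ Nless κ i T T' then 1 else 0) = (Nless κ i T T').ncard := by
    rw [Finset.sum_boole, ← Set.ncard_coe_finset, Nat.cast_id]
    congr 1
    ext x
    simp only [Finset.coe_filter, mB, Set.mem_ofPred_eq]
    exact ⟨fun hx => hx.2, fun hx => ⟨hx.1, hx⟩⟩
  have hweight : ∑ x ∈ B, weight κ i T T' x =
      ∑ x ∈ B, rdeg T' x + ((Nmid κ i T T').ncard + 2 * (Nless κ i T T').ncard) := by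
    unfold weight
    rw [Finset.sum_add_distrib, Finset.sum_add_distrib, ← Finset.mul_sum, ← hmid, ← hless]
  have hsize : size T' ≤ ∑ x ∈ S, rdeg T' x + (∑ x ∈ A, rdeg T' x + (∑ x ∈ B, rdeg T' x +
      ∑ x ∈ hafin.toFinset, rdeg T' x)) := by
    rw [size_eq_sum]
    have hsub : (finite_MaxSub T').toFinset ⊆ insert T' (S ∪ (A ∪ (B ∪ hafin.toFinset))) := by
      intro x hx
      have hx' := (Set.Finite.mem_toFinset _).1 hx
      simp only [Finset.mem_insert, Finset.mem_union, mA, mB, S, Finset.mem_filter, hx, true_and,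
        Set.Finite.mem_toFinset]
      by_cases h0 : x = T'
      · exact Or.inl h0
      by_cases h1 : x ∈ MaxSub T
      · exact Or.inr (Or.inl h1)
      have hN : x ∈ N T T' := ⟨⟨hx', h1⟩, h0⟩
      by_cases hL : x ∈ LeftM T
      · exact Or.inr (Or.inr (Or.inl ⟨hN, hL⟩))
      by_cases hR : x ∈ RightM T
      · exact Or.inr (Or.inr (Or.inr (Or.inl (Or.inl ⟨hN, hR⟩))))
      by_cases ha : x ∈ Nadd κ i T T'
      · exact Or.inr (Or.inr (Or.inr (Or.inr ha)))
      · exact Or.inr (Or.inr (Or.inr (Or.inl (Or.inr ⟨mem_N₃_iff.2 ⟨hN, hL, hR⟩, ha⟩))))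
    have hun : ∀ s t : Finset (List α), ∑ x ∈ s ∪ t, rdeg T' x ≤
        ∑ x ∈ s, rdeg T' x + ∑ x ∈ t, rdeg T' x := fun s t => by
      rw [← Finset.sum_union_inter]
      exact Nat.le_add_right _ _
    refine (Finset.sum_le_sum_of_subset hsub).trans ?_
    rw [Finset.insert_eq]
    refine (hun _ _).trans ?_
    rw [Finset.sum_singleton, rdeg_self, zero_add]
    refine (hun _ _).trans (Nat.add_le_add_left ?_ _)
    refine (hun _ _).trans (Nat.add_le_add_left ?_ _)
    exact hun _ _
  -- With (I) to (IV), `2|B| + 2|Q| + 2|K| ≤ 4m`, and the remaining `m` comes from (I).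
  omega

end

end CDAWG

theorem mainTheorem2 {α : Type*} (d : α) (κ : CDAWG.EditKind) (i : ℕ) (T T' : List α)
    (hT : CDAWG.EndsWithMarker d T) (hT' : CDAWG.EndsWithMarker d T')
    (hedit : CDAWG.IsEdit κ i T T') :
    (CDAWG.size T' : ℤ) ≤ 2 * (CDAWG.size T : ℤ) + 5 * ((CDAWG.MR T).ncard : ℤ)
      - ((CDAWG.Nmid κ i T T').ncard : ℤ) - 2 * ((CDAWG.Nless κ i T T').ncard : ℤ)
      + ((CDAWG.N₂ T T').ncard : ℤ) + 3 := by
  obtain ⟨off, j, h, hC⟩ := CDAWG.exists_edited hedit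
  have := h.size_add_le hT hT' hC
  omega
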